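/- Consider one quantum degree of freedom with $\hbar=1$ in the position representation: $Q f(x)=x f(x)$, $P f=-i f'$ on the Schwartz space $\mathcal S(\mathbb R)\subset L^2(\mathbb R)$, $a=(Q+iP)/\sqrt2$, $a^\dagger=(Q-iP)/\sqrt2$, number states $|n\rangle=(a^\dagger)^n|0\rangle/\sqrt{n!}$ with $\langle x|0\rangle=\pi^{-1/4}e^{-x^2/2}$, $e^{i\theta N}f=\sum_n e^{i\theta n}\langle n|f\rangle\,|n\rangle$, parity $\Pi f(x)=f(-x)$, displacements $D(q,p)=e^{i(pQ-qP)}$, that is $(D(q,p)f)(x)=e^{ip(x-q/2)}f(x-q)$, and coherent states $|z\rangle=D(q,p)|0\rangle$, $z=q+ip$. Generalized operators are given by their matrix elements between Schwartz functions; in particular $\langle f|q\rangle\langle q|g\rangle=\overline{f(q)}g(q)$ and $\langle f|p\rangle\langle p|g\rangle=\overline{\hat f(p)}\,\hat g(p)$ with $\hat f(p)=(2\pi)^{-1/2}\int e^{-ipx}f(x)\,dx$. The Wigner operator at $z=q+ip$ is $W(z)=\frac1\pi D(q,p)\Pi D(q,p)^\dagger$, and the region operator of a straight line $\ell$ in the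 phase plane is $K_\ell=\int_\ell W(z)\,d\ell(z)$ (arc length). Let $\ell_{\theta,s}=\{(q,p):q\cos\theta+p\sin\theta=s\}$, $K_{\theta,s}=K_{\ell_{\theta,s}}$, $Q_\theta=Q\cos\theta+P\sin\theta=(e^{i\theta}a^\dagger+e^{-i\theta}a)/\sqrt2$. Proposition. Every straight line in the phase plane is some $\ell_{\theta,s}$. The series for $e^{i\theta N}f$ converges in $\mathcal S(\mathbb R)$ for every $f\in\mathcal S(\mathbb R)$, the integrals defining the matrix elements of $K_{\theta,s}$ converge absolutely, and the following hold for all real $\theta,s,q,p$. (a) The operator of the $p$-axis is $K_{0,0}=\frac1\pi\int_{-\infty}^{\infty}D(0,p')\Pi D(0,p')^\dagger\,dp'$, and the operator of the line parallel to it through the point $q$ of the position axis is $K_{0,q}=D(q,0)K_{0,0}D(q,0)^\dagger=|q\rangle\langle q|$. (b) The operator of the $q$-axis is $K_{\pi/2,0}=\frac1\pi\int_{-\infty}^{\infty}D(q',0)\Pi D(q',0)^\dagger\,dq'$, and the operator of the line parallel to it through the point $p$ of the momentum axis is $K_{\pi/2,p}=D(0,p)K_{\pi/2,0}D(0,p)^\dagger=|p\rangle\langle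 p|$. (c) $K_{\theta,q}=e^{i\theta N}|q\rangle\langle q|e^{-i\theta N}$ and $K_{\theta+\pi/2,p}=e^{i\theta N}|p\rangle\langle p|e^{-i\theta N}$. (d) $K_{\theta,s}=\frac1{\sqrt\pi}:e^{-(s-Q_\theta)^2}:$ (for $\theta=0$ and $\theta=\pi/2$ this is $\frac1{\sqrt\pi}:e^{-(q-Q)^2}:$ and $\frac1{\sqrt\pi}:e^{-(p-P)^2}:$). That is, if $\frac1{\sqrt\pi}\exp\bigl(-(s-(e^{i\theta}x+e^{-i\theta}y)/\sqrt2)^2\bigr)=\sum_{m,n}c_{mn}x^my^n$, then $\langle f|K_{\theta,s}|g\rangle=\sum_{m,n}c_{mn}\langle a^mf|a^ng\rangle$, with an absolutely convergent sum, whenever $f$ and $g$ are finite linear combinations of number states, and whenever $f$ and $g$ are coherent states. (e) The $K_{\theta,s}$ are (generalized) projections: for each $\theta$ there are orthogonal projections $E_\theta(B)$ on $L^2(\mathbb R)$, $B\subseteq\mathbb R$ Borel, with $\langle f|E_\theta(B)|g\rangle=\int_B\langle f|K_{\theta,s}|g\rangle\,ds$ (an absolutely convergent integral) for all Schwartz $f,g$,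 with $E_\theta(B)E_\theta(C)=E_\theta(B\cap C)$, and with $E_\theta(\mathbb R)=1$. -/

import Mathlib

open MeasureTheory
open scoped SchwartzMap

noncomputable section

namespace PhaseSpace

/-! Quantum mechanics of one degree of freedom in the position representation, `ħ = 1`.  State
vectors with finite matrix elements are Schwartz functions `ℝ → ℂ`, a dense subspace of `L²(ℝ)`.
A point `(q, p)` of the classical phase space is the complex number `z = q + i p`. -/

/-- The inner product `⟨f|g⟩ = ∫ conj (f x) g x dx`. -/
def braket (f g : 𝓢(ℝ, ℂ)) : ℂ := ∫ x : ℝ, star (f x) * g x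

/-- The position operator, `(Q f)(x) = x f(x)`. -/
def posOp : 𝓢(ℝ, ℂ) →L[ℂ] 𝓢(ℝ, ℂ) := SchwartzMap.smulLeftCLM ℂ (fun x : ℝ => (x : ℂ))

/-- The momentum operator, `P f = -i f'`. -/
def momOp : 𝓢(ℝ, ℂ) →L[ℂ] 𝓢(ℝ, ℂ) := (-Complex.I) • SchwartzMap.derivCLM ℂ ℂ

/-- The annihilation operator `a = (Q + i P) / √2`. -/
def annihilation : 𝓢(ℝ, ℂ) →L[ℂ] 𝓢(ℝ, ℂ) :=
  ((Real.sqrt 2 : ℝ) : ℂ)⁻¹ • (posOp + Complex.I • momOp)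

/-- The creation operator `a† = (Q - i P) / √2`. -/
def creation : 𝓢(ℝ, ℂ) →L[ℂ] 𝓢(ℝ, ℂ) :=
  ((Real.sqrt 2 : ℝ) : ℂ)⁻¹ • (posOp - Complex.I • momOp)

/-- The parity operator, `(Π f)(x) = f(-x)`. -/
def parity : 𝓢(ℝ, ℂ) →L[ℂ] 𝓢(ℝ, ℂ) :=
  SchwartzMap.compCLMOfContinuousLinearEquiv ℂ (ContinuousLinearEquiv.neg ℝ)

/-- The displacement operator `D(q, p) = exp (i (p Q - q P))`, in closed form
`(D(q, p) f)(x) = exp (i p (x - q / 2)) f(x - q)`. -/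
def displacement (q p : ℝ) : 𝓢(ℝ, ℂ) →L[ℂ] 𝓢(ℝ, ℂ) :=
  (SchwartzMap.smulLeftCLM ℂ
    (fun x : ℝ => Complex.exp (Complex.I * ((p * (x - q / 2) : ℝ) : ℂ)))).comp
    (SchwartzMap.compSubConstCLM ℂ q)

theorem posOp_apply (f : 𝓢(ℝ, ℂ)) (x : ℝ) : posOp f x = x * f x := by
  rw [posOp, SchwartzMap.smulLeftCLM_apply_apply (by fun_prop)]
  rfl

theorem momOp_apply (f : 𝓢(ℝ, ℂ)) (x : ℝ) : momOp f x = -Complex.I * deriv f x := by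
  simp [momOp]

theorem parity_apply (f : 𝓢(ℝ, ℂ)) (x : ℝ) : parity f x = f (-x) := rfl

theorem hasTemperateGrowth_phase (q p : ℝ) :
    (fun x : ℝ => Complex.exp (Complex.I * ((p * (x - q / 2) : ℝ) : ℂ))).HasTemperateGrowth := by
  have hd : ∀ x : ℝ, HasDerivAt
      (fun x : ℝ => Complex.exp (Complex.I * ((p * (x - q / 2) : ℝ) : ℂ)))
      ((Complex.I * p) * Complex.exp (Complex.I * ((p * (x - q / 2) : ℝ) : ℂ))) x := by
    intro x
    have h1 : HasDerivAt (fun x : ℝ => p * (x - q / 2)) p x := by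
      simpa using ((hasDerivAt_id x).sub_const (q / 2)).const_mul p
    simpa [mul_comm] using (h1.ofReal_comp.const_mul Complex.I).cexp
  have hn : ∀ n : ℕ, iteratedDeriv n
      (fun x : ℝ => Complex.exp (Complex.I * ((p * (x - q / 2) : ℝ) : ℂ))) =
      fun x : ℝ => (Complex.I * p) ^ n *
        Complex.exp (Complex.I * ((p * (x - q / 2) : ℝ) : ℂ)) := by
    intro n
    induction n with
    | zero => simp
    | succ n ih =>
      rw [iteratedDeriv_succ, ih]
      funext x
      rw [((hd x).const_mul _).deriv, pow_succ]
      ring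
  refine ⟨Complex.contDiff_exp.comp
    (contDiff_const.mul (Complex.ofRealCLM.contDiff.comp
      (by fun_prop : ContDiff ℝ _ fun x : ℝ => p * (x - q / 2)))), fun n => ?_⟩
  refine ⟨0, |p| ^ n, fun x => ?_⟩
  rw [norm_iteratedFDeriv_eq_norm_iteratedDeriv, hn]
  simp only [norm_mul, norm_pow, Complex.norm_I, Complex.norm_real, Real.norm_eq_abs,
    mul_comm Complex.I (((p * (x - q / 2) : ℝ) : ℂ)), Complex.norm_exp_ofReal_mul_I]
  simp

theorem displacement_apply (q p : ℝ) (f : 𝓢(ℝ, ℂ)) (x : ℝ) :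
    displacement q p f x = Complex.exp (Complex.I * ((p * (x - q / 2) : ℝ) : ℂ)) * f (x - q) := by
  rw [displacement, ContinuousLinearMap.comp_apply,
    SchwartzMap.smulLeftCLM_apply_apply (hasTemperateGrowth_phase q p)]
  rfl

/-- `t ↦ D(t q, t p)` solves the equation that defines `exp (i t (p Q - q P))`. -/
theorem hasDerivAt_displacement (q p t x : ℝ) (f : 𝓢(ℝ, ℂ)) :
    HasDerivAt (fun t : ℝ => displacement (t * q) (t * p) f x)
      (Complex.I * ((p : ℂ) * posOp (displacement (t * q) (t * p) f) x
        - (q : ℂ) * momOp (displacement (t * q) (t * p) f) x)) t := by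
  have hf : ∀ y : ℝ, HasDerivAt f (deriv f y) y := fun y => f.hasDerivAt y
  have hx : deriv (displacement (t * q) (t * p) f) x =
      Complex.I * (t * p) * (Complex.exp (Complex.I * ((t * p * (x - t * q / 2) : ℝ) : ℂ)) *
        f (x - t * q)) +
      Complex.exp (Complex.I * ((t * p * (x - t * q / 2) : ℝ) : ℂ)) * deriv f (x - t * q) := by
    have h1 : HasDerivAt (fun x : ℝ => t * p * (x - t * q / 2)) (t * p) x := by
      simpa using ((hasDerivAt_id x).sub_const (t * q / 2)).const_mul (t * p)
    have h2 := (h1.ofReal_comp.const_mul Complex.I).cexp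
    have h3 : HasDerivAt (fun x : ℝ => f (x - t * q)) (deriv f (x - t * q)) x :=
      HasDerivAt.comp_sub_const x (t * q) (hf (x - t * q))
    have h4 : (displacement (t * q) (t * p) f : ℝ → ℂ) =
        fun x : ℝ => Complex.exp (Complex.I * ((t * p * (x - t * q / 2) : ℝ) : ℂ)) *
          f (x - t * q) := funext (displacement_apply _ _ f)
    rw [h4]
    refine (h2.mul h3).deriv.trans ?_
    push_cast
    ring
  have h5 : HasDerivAt (fun t : ℝ => t * p * (x - t * q / 2)) (p * x - t * (q * p)) t := by
    have := ((hasDerivAt_id t).mul_const p).mul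
      ((((hasDerivAt_id t).mul_const q).div_const 2).const_sub x)
    refine this.congr_deriv ?_
    simp only [id]
    ring
  have h6 : HasDerivAt (fun t : ℝ => x - t * q) (-q) t := by
    simpa using ((hasDerivAt_id t).mul_const q).const_sub x
  have h7 := (h5.ofReal_comp.const_mul Complex.I).cexp.mul ((hf (x - t * q)).scomp t h6)
  simp only [displacement_apply, posOp_apply, momOp_apply, hx]
  refine h7.congr_deriv ?_
  simp only [Complex.real_smul, Function.comp_apply]
  push_cast
  linear_combination -(q * Complex.exp (Complex.I * (t * p * (x - t * q / 2))) *
    deriv f (x - t * q) + q * (Complex.I * (t * p)) *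
    Complex.exp (Complex.I * (t * p * (x - t * q / 2))) * f (x - t * q)) * Complex.I_mul_I

theorem displacement_zero (f : 𝓢(ℝ, ℂ)) : displacement 0 0 f = f := by
  ext x
  simp [displacement_apply]

/-- `D(q, p)† = D(-q, -p)`. -/
theorem braket_displacement (q p : ℝ) (f g : 𝓢(ℝ, ℂ)) :
    braket f (displacement q p g) = braket (displacement (-q) (-p) f) g := by
  unfold braket
  rw [← integral_add_right_eq_self (fun x : ℝ => star (f x) * displacement q p g x) q]
  refine integral_congr_ae (Filter.Eventually.of_forall fun x => ?_)
  simp only [displacement_apply, star_mul', Complex.star_def, ← Complex.exp_conj, map_mul,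
    Complex.conj_I, Complex.conj_ofReal, add_sub_cancel_right, sub_neg_eq_add]
  have h : Complex.I * ((p * (x + q - q / 2) : ℝ) : ℂ) =
      -Complex.I * ((-p * (x - -q / 2) : ℝ) : ℂ) := by
    push_cast
    ring
  rw [h]
  ring

theorem displacement_neg (q p : ℝ) (f : 𝓢(ℝ, ℂ)) :
    displacement q p (displacement (-q) (-p) f) = f := by
  ext x
  simp only [displacement_apply, ← mul_assoc, ← Complex.exp_add]
  have h : Complex.I * ((p * (x - q / 2) : ℝ) : ℂ) +
      Complex.I * ((-p * (x - q - -q / 2) : ℝ) : ℂ) = 0 := by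
    push_cast
    ring
  rw [h, Complex.exp_zero, one_mul]
  congr 1
  ring

theorem gaussian_decay (k n : ℕ) : ∃ C : ℝ, ∀ x : ℝ, ‖x‖ ^ k *
    ‖iteratedFDeriv ℝ n (fun x : ℝ => ((Real.exp (-(x ^ 2 / 2)) : ℝ) : ℂ)) x‖ ≤ C := by
  have hpow : ∀ j : ℕ, ∃ C : ℝ, ∀ x : ℝ, |x ^ j| * Real.exp (-(x ^ 2 / 2)) ≤ C := by
    intro j
    refine ⟨1 + 2 ^ j * j.factorial, fun x => ?_⟩
    have h1 : (x ^ 2 / 2) ^ j / j.factorial ≤ Real.exp (x ^ 2 / 2) :=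
      Real.pow_div_factorial_le_exp _ (by positivity) j
    have hj : (0 : ℝ) < j.factorial := by positivity
    have h2 : |x ^ j| ^ 2 ≤ 2 ^ j * j.factorial * Real.exp (x ^ 2 / 2) := by
      rw [div_le_iff₀ hj, div_pow, div_le_iff₀ (by positivity)] at h1
      rw [sq_abs, ← pow_mul, mul_comm j 2, pow_mul]
      linarith
    have h3 : 1 ≤ Real.exp (x ^ 2 / 2) := Real.one_le_exp (by positivity)
    have h4 : |x ^ j| ≤ 1 + |x ^ j| ^ 2 := by nlinarith [sq_nonneg (|x ^ j| - 1), abs_nonneg (x ^ j)]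
    rw [Real.exp_neg, ← div_eq_mul_inv, div_le_iff₀ (Real.exp_pos _)]
    linarith
  have hpoly : ∀ P : Polynomial ℝ, ∃ C : ℝ, ∀ x : ℝ,
      |P.eval x| * Real.exp (-(x ^ 2 / 2)) ≤ C := by
    intro P
    induction P using Polynomial.induction_on' with
    | add P R hP hR =>
      obtain ⟨C, hC⟩ := hP
      obtain ⟨D, hD⟩ := hR
      refine ⟨C + D, fun x => ?_⟩
      have h := mul_le_mul_of_nonneg_right (abs_add_le (P.eval x) (R.eval x))
        (Real.exp_pos (-(x ^ 2 / 2))).le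
      rw [Polynomial.eval_add]
      linarith [hC x, hD x]
    | monomial j c =>
      obtain ⟨C, hC⟩ := hpow j
      refine ⟨|c| * C, fun x => ?_⟩
      rw [Polynomial.eval_monomial, abs_mul, mul_assoc]
      exact mul_le_mul_of_nonneg_left (hC x) (abs_nonneg c)
  have hiter : ∀ m : ℕ, iteratedDeriv m (fun x : ℝ => ((Real.exp (-(x ^ 2 / 2)) : ℝ) : ℂ)) =
      fun x : ℝ => ((deriv^[m] (fun y : ℝ => Real.exp (-(y ^ 2 / 2))) x : ℝ) : ℂ) := by
    intro m
    induction m with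
    | zero => rfl
    | succ m ih =>
      rw [iteratedDeriv_succ, ih]
      funext x
      have hd : DifferentiableAt ℝ (deriv^[m] (fun y : ℝ => Real.exp (-(y ^ 2 / 2)))) x := by
        rw [funext (Polynomial.deriv_gaussian_eq_hermite_mul_gaussian m)]
        have := ((Polynomial.hermite m).map (Int.castRingHom ℝ)).differentiable (𝕜 := ℝ)
        simp only [Polynomial.eval_map, Polynomial.aeval_def] at this ⊢
        fun_prop
      rw [Function.iterate_succ_apply']
      exact hd.hasDerivAt.ofReal_comp.deriv
  obtain ⟨C, hC⟩ := hpoly (Polynomial.X ^ k * (Polynomial.hermite n).map (Int.castRingHom ℝ))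
  refine ⟨C, fun x => ?_⟩
  rw [norm_iteratedFDeriv_eq_norm_iteratedDeriv, hiter]
  refine le_of_eq_of_le ?_ (hC x)
  simp only []
  rw [Polynomial.deriv_gaussian_eq_hermite_mul_gaussian, Complex.norm_real, Polynomial.eval_mul,
    Polynomial.eval_map, Polynomial.aeval_def]
  simp [abs_mul, mul_assoc]

/-- The Gaussian `exp (-x² / 2)` as a Schwartz function. -/
def gaussian : 𝓢(ℝ, ℂ) where
  toFun x := ((Real.exp (-(x ^ 2 / 2)) : ℝ) : ℂ)
  smooth' := Complex.ofRealCLM.contDiff.comp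
    (Real.contDiff_exp.comp (by fun_prop : ContDiff ℝ _ fun x : ℝ => -(x ^ 2 / 2)))
  decay' := gaussian_decay

/-- The number state `|n⟩ = (a†)ⁿ |0⟩ / √(n!)`, with `⟨x|0⟩ = π ^ (-1/4) exp (-x² / 2)`. -/
def numberState (n : ℕ) : 𝓢(ℝ, ℂ) :=
  ((Real.sqrt (n.factorial : ℝ) : ℝ) : ℂ)⁻¹ •
    (creation ^ n) (((Real.pi ^ (-(1 / 4) : ℝ) : ℝ) : ℂ) • gaussian)

/-- The coherent state `|z⟩ = D(q, p) |0⟩` at the point `z = q + i p`. -/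
def coherentState (z : ℂ) : 𝓢(ℝ, ℂ) := displacement z.re z.im (numberState 0)

/-- The terms of `e^{i θ N} f = ∑ₙ e^{i θ n} ⟨n|f⟩ |n⟩`, where `N |n⟩ = n |n⟩`. -/
def numberRotationTerm (θ : ℝ) (f : 𝓢(ℝ, ℂ)) (n : ℕ) : 𝓢(ℝ, ℂ) :=
  (Complex.exp (Complex.I * θ * n) * braket (numberState n) f) • numberState n

/-- The rotation `e^{i θ N}`; the series is taken in the topology of the Schwartz space. -/
def numberRotation (θ : ℝ) (f : 𝓢(ℝ, ℂ)) : 𝓢(ℝ, ℂ) := ∑' n, numberRotationTerm θ f n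

/-- A generalized operator `K` is given by its matrix elements `⟨f|K|g⟩`. -/
abbrev GenOp := 𝓢(ℝ, ℂ) → 𝓢(ℝ, ℂ) → ℂ

/-- `V K V†`, in terms of the adjoint `V†`: `⟨f|V K V†|g⟩ = ⟨V† f|K|V† g⟩`. -/
def GenOp.conjugate (K : GenOp) (Vadj : 𝓢(ℝ, ℂ) → 𝓢(ℝ, ℂ)) : GenOp :=
  fun f g => K (Vadj f) (Vadj g)

/-- `|q⟩⟨q|`, where `⟨q|g⟩ = g(q)`. -/
def posProj (q : ℝ) : GenOp := fun f g => star (f q) * g q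

/-- The momentum amplitude `⟨p|g⟩ = (2π)^{-1/2} ∫ e^{-i p x} g(x) dx`. -/
def momAmplitude (p : ℝ) (g : 𝓢(ℝ, ℂ)) : ℂ :=
  ((Real.sqrt (2 * Real.pi) : ℝ) : ℂ)⁻¹ *
    ∫ x : ℝ, Complex.exp (-(Complex.I * ((p * x : ℝ) : ℂ))) * g x

/-- `|p⟩⟨p|`. -/
def momProj (p : ℝ) : GenOp := fun f g => star (momAmplitude p f) * momAmplitude p g

/-- The displaced parity operator `D(q, p) Π D(q, p)†`. -/
def displacedParity (q p : ℝ) : 𝓢(ℝ, ℂ) →L[ℂ] 𝓢(ℝ, ℂ) :=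
  (displacement q p).comp (parity.comp (displacement (-q) (-p)))

/-- The Wigner operator `W(z) = π⁻¹ D(q, p) Π D(q, p)†` at `z = q + i p`; `⟨f|W(z)|f⟩` is the Wigner
function of `f`. -/
def wigner (z : ℂ) : 𝓢(ℝ, ℂ) →L[ℂ] 𝓢(ℝ, ℂ) :=
  ((Real.pi : ℝ) : ℂ)⁻¹ • displacedParity z.re z.im

/-- The region operator `∫ W(z) dμ(z)`, where `μ` is the natural measure on the region. -/
def regionOp (μ : Measure ℂ) : GenOp := fun f g => ∫ z, braket f (wigner z g) ∂μ

/-- The straight line `{(q, p) : q cos θ + p sin θ = s}`. -/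
def phaseLine (θ s : ℝ) : Set ℂ := {z | z.re * Real.cos θ + z.im * Real.sin θ = s}

/-- The region operator supported on a straight line (with its arc length). -/
def lineOp (θ s : ℝ) : GenOp := regionOp ((μH[1]).restrict (phaseLine θ s))

/-- The coefficient of `x ^ m * y ^ n` in the power series of an entire function `F x y`. -/
def taylorCoeff (F : ℂ → ℂ → ℂ) (m n : ℕ) : ℂ :=
  iteratedDeriv m (fun x => iteratedDeriv n (fun y => F x y) 0) 0 /
    ((m.factorial : ℂ) * (n.factorial : ℂ))

/-- The terms of `⟨f|:F(a†, a):|g⟩`, where `:F(a†, a): = ∑ cₘₙ (a†)ᵐ aⁿ` if `F x y = ∑ cₘₙ xᵐ yⁿ`. -/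
def normalOrderTerm (F : ℂ → ℂ → ℂ) (f g : 𝓢(ℝ, ℂ)) (mn : ℕ × ℕ) : ℂ :=
  taylorCoeff F mn.1 mn.2 * braket ((annihilation ^ mn.1) f) ((annihilation ^ mn.2) g)

/-- The rotated position `Q_θ = Q cos θ + P sin θ = (e^{i θ} a† + e^{-i θ} a) / √2` as a function of
`x = a†` and `y = a`; `θ = 0` is `Q` and `θ = π / 2` is `P`. -/
def quadratureSymbol (θ : ℝ) (x y : ℂ) : ℂ :=
  (Complex.exp (Complex.I * θ) * x + Complex.exp (-(Complex.I * θ)) * y) / ((Real.sqrt 2 : ℝ) : ℂ)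

/-- `π^{-1/2} exp (-(s - Q_θ)²)` as a function of `x = a†` and `y = a`. -/
def lineSymbol (θ s : ℝ) (x y : ℂ) : ℂ :=
  ((Real.sqrt Real.pi : ℝ) : ℂ)⁻¹ * Complex.exp (-((s : ℂ) - quadratureSymbol θ x y) ^ 2)

end PhaseSpace

end

noncomputable section

namespace PhaseSpace

open Filter Topology

/-! The displaced parity at a point `z` reflects the phase plane about `z`. If `z` lies on the line
with parameters `θ`, `s`, it therefore carries `Q_θ` to `2s - Q_θ`. Moving `z` along the line is a
displacement generated by `Q_θ`, so the derivative of the displaced parity along the line is the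
displaced parity composed with `2i(s - Q_θ)`. The integral of this derivative vanishes, which gives
`⟨f|K|Q_θ g⟩ = s ⟨f|K|g⟩` (`lineOp_quadratureOp`).

In the number basis this eigenvalue equation is a three-term recurrence, the Hermite recurrence up
to phases, so a continuous eigenfunctional is fixed by its value on the vacuum and is a multiple of
`g ↦ (e^{-iθN} g)(s)` (`apply_eq_of_quadratureOp_eigen`). Hermitian symmetry of `K` and one Gaussian
integral for the vacuum fix the multiple, and `⟨f|K|g⟩` is the conjugate of `(e^{-iθN} f)(s)` times
`(e^{-iθN} g)(s)` (`lineOp_apply`). Everything else rests on this formula. The same uniqueness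
identifies the Fourier transform with `e^{-iπN/2}`, which settles the lines parallel to the
`q`-axis. On `L²` the projections are multiplications by indicator functions conjugated by the
unitary `e^{iθN}`.

The analytic basis is that seminorms of number states grow polynomially while number coefficients of
a Schwartz function decay rapidly, and that number states are complete. Normal ordering between
coherent states is a Taylor expansion, since they are eigenvectors of `a`. Between number states,
the normally ordered series satisfies the same eigenvalue equation as `K`, and induction from the
vacuum finishes the proof. -/

/-! ### Inner product and ladder operators on Schwartz space. -/

theorem creation_apply (f : 𝓢(ℝ, ℂ)) (x : ℝ) :
    creation f x = ((√2 : ℝ) : ℂ)⁻¹ * (x * f x - deriv f x) := by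
  simp only [creation, smul_apply, sub_apply, posOp_apply, momOp_apply, smul_eq_mul]
  linear_combination (((√2 : ℝ) : ℂ)⁻¹ * deriv f x) * Complex.I_mul_I

theorem annihilation_apply (f : 𝓢(ℝ, ℂ)) (x : ℝ) :
    annihilation f x = ((√2 : ℝ) : ℂ)⁻¹ * (x * f x + deriv f x) := by
  simp only [annihilation, smul_apply, add_apply, posOp_apply, momOp_apply, smul_eq_mul]
  linear_combination -(((√2 : ℝ) : ℂ)⁻¹ * deriv f x) * Complex.I_mul_I

/-- The pointwise complex conjugate of a Schwartz function. -/
def conjSchwartz (f : 𝓢(ℝ, ℂ)) : 𝓢(ℝ, ℂ) :=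
  SchwartzMap.postcompCLM (𝕜 := ℝ) (Complex.conjCLE : ℂ →L[ℝ] ℂ) f

theorem conjSchwartz_apply (f : 𝓢(ℝ, ℂ)) (x : ℝ) : conjSchwartz f x = star (f x) := rfl

/-- The bra `⟨f|` as a continuous linear functional. -/
def braketCLM (f : 𝓢(ℝ, ℂ)) : 𝓢(ℝ, ℂ) →L[ℂ] ℂ :=
  (SchwartzMap.integralCLM ℂ volume).comp (SchwartzMap.smulLeftCLM ℂ (conjSchwartz f))

theorem braketCLM_apply (f g : 𝓢(ℝ, ℂ)) : braketCLM f g = braket f g := by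
  rw [braketCLM, ContinuousLinearMap.comp_apply, SchwartzMap.integralCLM_apply, braket]
  refine integral_congr_ae (Filter.Eventually.of_forall fun x => ?_)
  simp only [SchwartzMap.smulLeftCLM_apply_apply (conjSchwartz f).hasTemperateGrowth,
    conjSchwartz_apply, smul_eq_mul]

theorem integrable_braket (f g : 𝓢(ℝ, ℂ)) : Integrable fun x : ℝ => star (f x) * g x := by
  refine (SchwartzMap.smulLeftCLM ℂ (conjSchwartz f) g).integrable.congr
    (Filter.Eventually.of_forall fun x => ?_)
  simp only [SchwartzMap.smulLeftCLM_apply_apply (conjSchwartz f).hasTemperateGrowth,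
    conjSchwartz_apply, smul_eq_mul]

theorem braket_add_right (f g h : 𝓢(ℝ, ℂ)) : braket f (g + h) = braket f g + braket f h := by
  simp only [← braketCLM_apply, map_add]

theorem braket_sub_right (f g h : 𝓢(ℝ, ℂ)) : braket f (g - h) = braket f g - braket f h := by
  simp only [← braketCLM_apply, map_sub]

theorem braket_smul_right (c : ℂ) (f g : 𝓢(ℝ, ℂ)) : braket f (c • g) = c * braket f g := by
  simp only [← braketCLM_apply, map_smul, smul_eq_mul]

theorem braket_zero_right (f : 𝓢(ℝ, ℂ)) : braket f 0 = 0 := by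
  simp only [← braketCLM_apply, map_zero]

theorem star_braket (f g : 𝓢(ℝ, ℂ)) : star (braket f g) = braket g f := by
  rw [braket, Complex.star_def, ← integral_conj]
  refine integral_congr_ae (Filter.Eventually.of_forall fun x => ?_)
  simp [mul_comm]

theorem braket_add_left (f g h : 𝓢(ℝ, ℂ)) : braket (f + g) h = braket f h + braket g h := by
  rw [← star_braket, braket_add_right, star_add, star_braket, star_braket h g]

theorem braket_sub_left (f g h : 𝓢(ℝ, ℂ)) : braket (f - g) h = braket f h - braket g h := by
  rw [← star_braket, braket_sub_right, star_sub, star_braket, star_braket h g]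

theorem braket_smul_left (c : ℂ) (f g : 𝓢(ℝ, ℂ)) : braket (c • f) g = star c * braket f g := by
  rw [← star_braket, braket_smul_right, star_mul', star_braket]

theorem braket_zero_left (f : 𝓢(ℝ, ℂ)) : braket 0 f = 0 := by
  rw [← star_braket, braket_zero_right, star_zero]

theorem braket_posOp (f g : 𝓢(ℝ, ℂ)) : braket f (posOp g) = braket (posOp f) g := by
  refine integral_congr_ae (Filter.Eventually.of_forall fun x => ?_)
  simp only [posOp_apply, star_mul', Complex.star_def, Complex.conj_ofReal]
  ring

theorem deriv_conjSchwartz (f : 𝓢(ℝ, ℂ)) (x : ℝ) :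
    deriv (conjSchwartz f) x = star (deriv f x) :=
  ((Complex.conjCLE : ℂ →L[ℝ] ℂ).hasFDerivAt.comp_hasDerivAt x (f.hasDerivAt x)).deriv

theorem braket_momOp (f g : 𝓢(ℝ, ℂ)) : braket f (momOp g) = braket (momOp f) g := by
  have h := SchwartzMap.integral_mul_deriv_eq_neg_deriv_mul (conjSchwartz f) g
  simp only [deriv_conjSchwartz, conjSchwartz_apply] at h
  have h1 : braket f (momOp g) = -Complex.I * ∫ x, star (f x) * deriv g x := by
    rw [braket, ← integral_const_mul]
    refine integral_congr_ae (Filter.Eventually.of_forall fun x => ?_)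
    simp only [momOp_apply]
    ring
  have h2 : braket (momOp f) g = Complex.I * ∫ x, star (deriv f x) * g x := by
    rw [braket, ← integral_const_mul]
    refine integral_congr_ae (Filter.Eventually.of_forall fun x => ?_)
    simp [momOp_apply, mul_assoc]
  rw [h1, h2, h]
  ring

theorem star_sqrt_two_inv : star ((√2 : ℝ) : ℂ)⁻¹ = ((√2 : ℝ) : ℂ)⁻¹ := by
  simp

theorem braket_annihilation (f g : 𝓢(ℝ, ℂ)) :
    braket f (annihilation g) = braket (creation f) g := by
  simp only [annihilation, creation, smul_apply, sub_apply,
    add_apply, braket_smul_right, braket_smul_left, braket_add_right,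
    braket_sub_left, star_sqrt_two_inv, braket_posOp, braket_momOp]
  simp only [Complex.star_def, Complex.conj_I]
  ring

theorem braket_creation (f g : 𝓢(ℝ, ℂ)) :
    braket f (creation g) = braket (annihilation f) g := by
  rw [← star_braket, ← braket_annihilation, star_braket]

theorem sqrt_two_inv_mul_self : ((√2 : ℝ) : ℂ)⁻¹ * ((√2 : ℝ) : ℂ)⁻¹ = 1 / 2 := by
  rw [← mul_inv, ← Complex.ofReal_mul, Real.mul_self_sqrt (by norm_num)]
  norm_num

theorem sqrt_two_inv_mul_two : ((√2 : ℝ) : ℂ)⁻¹ * 2 = ((√2 : ℝ) : ℂ) := by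
  have h : ((√2 : ℝ) : ℂ) * ((√2 : ℝ) : ℂ) = 2 := by
    rw [← Complex.ofReal_mul, Real.mul_self_sqrt (by norm_num)]
    norm_num
  have h0 : ((√2 : ℝ) : ℂ) ≠ 0 := by
    intro h0
    rw [h0] at h
    norm_num at h
  rw [← h, inv_mul_cancel_left₀ h0]

theorem momOp_posOp (f : 𝓢(ℝ, ℂ)) : momOp (posOp f) = posOp (momOp f) - Complex.I • f := by
  ext x
  have h : deriv (posOp f) x = f x + x * deriv f x := by
    have h1 : (posOp f : ℝ → ℂ) = fun x : ℝ => (x : ℂ) * f x := funext (posOp_apply f)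
    rw [h1]
    refine ((hasDerivAt_id x).ofReal_comp.mul (f.hasDerivAt x)).deriv.trans ?_
    simp
  simp only [momOp_apply, h, posOp_apply, sub_apply, smul_apply,
    smul_eq_mul]
  ring

theorem annihilation_creation (f : 𝓢(ℝ, ℂ)) :
    annihilation (creation f) = creation (annihilation f) + f := by
  simp only [annihilation, creation, smul_apply, sub_apply,
    add_apply, map_smul, map_add, map_sub, momOp_posOp]
  ext x
  simp only [add_apply, sub_apply, smul_apply, smul_eq_mul]
  linear_combination (-2 * Complex.I ^ 2 * f x) * sqrt_two_inv_mul_self - f x * Complex.I_sq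

theorem posOp_eq (f : 𝓢(ℝ, ℂ)) :
    posOp f = ((√2 : ℝ) : ℂ)⁻¹ • (creation f + annihilation f) := by
  ext x
  simp only [posOp_apply, smul_apply, add_apply, creation_apply,
    annihilation_apply, smul_eq_mul]
  linear_combination (-2 * x * f x) * sqrt_two_inv_mul_self

theorem momOp_eq (f : 𝓢(ℝ, ℂ)) :
    momOp f = (((√2 : ℝ) : ℂ)⁻¹ * Complex.I) • (creation f - annihilation f) := by
  ext x
  simp only [momOp_apply, smul_apply, sub_apply, creation_apply,
    annihilation_apply, smul_eq_mul]
  linear_combination (2 * Complex.I * deriv f x) * sqrt_two_inv_mul_self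

/-! ### Vacuum, number states and coherent states. -/

theorem gaussian_apply (x : ℝ) : gaussian x = ((Real.exp (-(x ^ 2 / 2)) : ℝ) : ℂ) := rfl

theorem annihilation_gaussian : annihilation gaussian = 0 := by
  ext x
  have h : deriv gaussian x = -x * gaussian x := by
    have h1 : HasDerivAt (fun x : ℝ => Real.exp (-(x ^ 2 / 2)))
        (Real.exp (-(x ^ 2 / 2)) * (-x)) x := by
      have h2 : HasDerivAt (fun x : ℝ => -(x ^ 2 / 2)) (-x) x := by
        refine (((hasDerivAt_id x).pow 2).div_const 2).neg.congr_deriv ?_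
        simp
      exact h2.exp
    refine h1.ofReal_comp.deriv.trans ?_
    simp only [gaussian_apply]
    push_cast
    ring
  simp only [annihilation_apply, h, zero_apply]
  ring

theorem creation_numberState (n : ℕ) :
    creation (numberState n) = ((√(n + 1 : ℝ) : ℝ) : ℂ) • numberState (n + 1) := by
  have h0 : ((√(n + 1 : ℝ) : ℝ) : ℂ) ≠ 0 := by
    rw [Complex.ofReal_ne_zero]
    positivity
  simp only [numberState, map_smul, pow_succ' creation, mul_apply_eq_comp, smul_smul]
  congr 1
  rw [Nat.factorial_succ, Nat.cast_mul, Nat.cast_succ, Real.sqrt_mul (by positivity)]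
  push_cast
  rw [mul_inv, mul_assoc, mul_inv_cancel_left₀ h0]

theorem annihilation_numberState_zero : annihilation (numberState 0) = 0 := by
  simp [numberState, annihilation_gaussian]

theorem sqrt_cast_mul_self (n : ℕ) :
    ((√(n : ℝ) : ℝ) : ℂ) * ((√(n : ℝ) : ℝ) : ℂ) = n := by
  rw [← Complex.ofReal_mul, Real.mul_self_sqrt (by positivity)]
  norm_num

theorem numberState_succ (n : ℕ) :
    numberState (n + 1) = ((√(n + 1 : ℝ) : ℝ) : ℂ)⁻¹ • creation (numberState n) := by
  have h0 : ((√(n + 1 : ℝ) : ℝ) : ℂ) ≠ 0 := by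
    rw [Complex.ofReal_ne_zero]
    positivity
  rw [creation_numberState, smul_smul, inv_mul_cancel₀ h0, one_smul]

/-- The commutator `[a, a†] = 1` gives `a†a|n⟩ = n|n⟩` by induction; then `a a† = a†a + 1` is
applied to `|n⟩`. -/
theorem annihilation_numberState_succ (n : ℕ) :
    annihilation (numberState (n + 1)) = ((√(n + 1 : ℝ) : ℝ) : ℂ) • numberState n := by
  have h0 : ∀ n : ℕ, ((√(n + 1 : ℝ) : ℝ) : ℂ) ≠ 0 := fun n => by
    rw [Complex.ofReal_ne_zero]
    positivity
  have hs : ∀ n : ℕ, ((√(n + 1 : ℝ) : ℝ) : ℂ) * ((√(n + 1 : ℝ) : ℝ) : ℂ) = n + 1 := fun n => by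
    simpa using sqrt_cast_mul_self (n + 1)
  have hsm : ∀ (n : ℕ) (f : 𝓢(ℝ, ℂ)), (n : ℂ) • f + f = (n + 1 : ℂ) • f := fun n f => by
    rw [add_smul, one_smul]
  have hN : creation (annihilation (numberState n)) = (n : ℂ) • numberState n := by
    induction n with
    | zero => simp [annihilation_numberState_zero]
    | succ n ih =>
      rw [numberState_succ, map_smul, annihilation_creation, ih, hsm, map_smul, smul_comm,
        Nat.cast_succ, map_smul]
  rw [numberState_succ, map_smul, annihilation_creation, hN, hsm, smul_smul,
    ← hs n, inv_mul_cancel_left₀ (h0 n)]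

/-- The truncated `n - 1` is harmless at `n = 0`, where the coefficient `√0` vanishes; this allows
recurrences without a case split. -/
theorem annihilation_numberState (n : ℕ) :
    annihilation (numberState n) = ((√(n : ℝ) : ℝ) : ℂ) • numberState (n - 1) := by
  cases n with
  | zero => simp [annihilation_numberState_zero]
  | succ n => simpa using annihilation_numberState_succ n

theorem numberState_zero_apply (x : ℝ) :
    numberState 0 x = (Real.pi ^ (-(1 / 4) : ℝ) : ℝ) * Complex.exp (-((x : ℂ) ^ 2 / 2)) := by
  simp [numberState, gaussian_apply]

theorem numberState_zero_apply_ne_zero (x : ℝ) : numberState 0 x ≠ 0 := by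
  rw [numberState_zero_apply]
  refine mul_ne_zero ?_ (Complex.exp_ne_zero _)
  rw [Complex.ofReal_ne_zero]
  positivity

theorem pi_rpow_mul_self : ((Real.pi ^ (-(1 / 4) : ℝ) : ℝ) : ℂ) * (Real.pi ^ (-(1 / 4) : ℝ) : ℝ) =
    ((√Real.pi : ℝ) : ℂ)⁻¹ := by
  rw [← Complex.ofReal_mul, ← Real.rpow_add Real.pi_pos, Real.sqrt_eq_rpow, ← Complex.ofReal_inv,
    ← Real.rpow_neg Real.pi_pos.le]
  norm_num

/-- In this form the exponent is holomorphic in `z` apart from the normalization `-|z|²/4`. -/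
theorem coherentState_apply (z : ℂ) (x : ℝ) :
    coherentState z x = (Real.pi ^ (-(1 / 4) : ℝ) : ℝ) *
      Complex.exp (x * z - x ^ 2 / 2 - z ^ 2 / 4 - z * star z / 4) := by
  rw [coherentState, displacement_apply, numberState_zero_apply, mul_left_comm, ← Complex.exp_add]
  congr 2
  conv_rhs => rw [← Complex.re_add_im z]
  simp only [star_add, star_mul', Complex.star_def, Complex.conj_ofReal, Complex.conj_I]
  push_cast
  ring

theorem coherentState_zero : coherentState 0 = numberState 0 := by
  simp [coherentState, displacement_zero]

theorem annihilation_coherentState (z : ℂ) :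
    annihilation (coherentState z) = (((√2 : ℝ) : ℂ)⁻¹ * z) • coherentState z := by
  ext x
  have h : deriv (coherentState z) x = (z - x) * coherentState z x := by
    have h1 : (coherentState z : ℝ → ℂ) = fun x : ℝ => ((Real.pi ^ (-(1 / 4) : ℝ) : ℝ) : ℂ) *
      Complex.exp (x * z - x ^ 2 / 2 - z ^ 2 / 4 - z * star z / 4) := funext (coherentState_apply z)
    have h2 : HasDerivAt (fun x : ℝ => (x * z - x ^ 2 / 2 - z ^ 2 / 4 - z * star z / 4 : ℂ))
        (z - x) x := by
      have h3 := (hasDerivAt_id x).ofReal_comp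
      refine ((((h3.mul_const z).sub ((h3.pow 2).div_const 2)).sub_const _).sub_const _).congr_deriv
        ?_
      simp
    rw [h1, (h2.cexp.const_mul _).deriv]
    ring
  simp only [annihilation_apply, h, smul_apply, smul_eq_mul]
  ring

theorem braket_coherentState (w z : ℂ) : braket (coherentState w) (coherentState z) =
    Complex.exp (star w * z / 2 - w * star w / 4 - z * star z / 4) := by
  have h : ∀ x : ℝ, star (coherentState w x) * coherentState z x = ((√Real.pi : ℝ) : ℂ)⁻¹ *
      Complex.exp (-1 * (x : ℂ) ^ 2 + (star w + z) * x +
        (-star w ^ 2 / 4 - w * star w / 4 - z ^ 2 / 4 - z * star z / 4)) := by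
    intro x
    rw [coherentState_apply, coherentState_apply z, star_mul', Complex.star_def,
      Complex.conj_ofReal, ← Complex.exp_conj, mul_mul_mul_comm, pi_rpow_mul_self,
      ← Complex.exp_add]
    congr 2
    simp only [map_sub, map_mul, map_div₀, map_pow, Complex.conj_ofReal, map_ofNat,
      Complex.conj_conj]
    ring
  have hpi : ((Real.pi : ℂ) / -(-1)) ^ (1 / 2 : ℂ) = ((√Real.pi : ℝ) : ℂ) := by
    rw [neg_neg, div_one, Real.sqrt_eq_rpow, Complex.ofReal_cpow Real.pi_pos.le]
    norm_num
  have h0 : ((√Real.pi : ℝ) : ℂ) ≠ 0 := by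
    rw [Complex.ofReal_ne_zero]
    positivity
  rw [braket, integral_congr_ae (Filter.Eventually.of_forall h), integral_const_mul,
    integral_cexp_quadratic (by norm_num), hpi, inv_mul_cancel_left₀ h0]
  congr 1
  ring

/-- Moving one ladder operator across the bracket lowers both indices, down to the annihilated
vacuum. -/
theorem braket_numberState (m n : ℕ) :
    braket (numberState m) (numberState n) = if m = n then 1 else 0 := by
  have h0 : ∀ n : ℕ, ((√(n + 1 : ℝ) : ℝ) : ℂ) ≠ 0 := fun n => by
    rw [Complex.ofReal_ne_zero]
    positivity
  have hs : ∀ n : ℕ, star ((√(n + 1 : ℝ) : ℝ) : ℂ)⁻¹ = ((√(n + 1 : ℝ) : ℝ) : ℂ)⁻¹ := fun n => by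
    rw [← Complex.ofReal_inv, Complex.star_def, Complex.conj_ofReal]
  induction m generalizing n with
  | zero =>
    cases n with
    | zero => simp [← coherentState_zero, braket_coherentState]
    | succ n =>
      rw [numberState_succ, braket_smul_right, braket_creation, annihilation_numberState_zero,
        braket_zero_left, mul_zero, if_neg (Nat.succ_ne_zero n).symm]
  | succ m ih =>
    rw [numberState_succ m, braket_smul_left, ← braket_annihilation]
    cases n with
    | zero => simp [annihilation_numberState_zero, braket_zero_right]
    | succ n =>
      rw [annihilation_numberState_succ, braket_smul_right, ih, hs]
      by_cases hmn : m = n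
      · subst hmn
        simp [h0 m]
      · simp [hmn]

/-! ### Growth of number states, decay of coefficients, convergence in Schwartz space. -/

/-- One-dimensional Sobolev inequality: integrate the derivative of `|f|²` from `-∞` to `x` and use
`2|f||f'| ≤ |f|² + |f'|²`. -/
theorem norm_sq_apply_le (f : 𝓢(ℝ, ℂ)) (x : ℝ) :
    ‖f x‖ ^ 2 ≤ (braket f f).re + (braket (momOp f) (momOp f)).re := by
  have hre : ∀ f : 𝓢(ℝ, ℂ), (braket f f).re = ∫ y, ‖f y‖ ^ 2 ∧ Integrable fun y => ‖f y‖ ^ 2 := by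
    intro f
    have h : ∀ y, star (f y) * f y = ((‖f y‖ ^ 2 : ℝ) : ℂ) := fun y => by
      rw [Complex.star_def, Complex.conj_mul']
      norm_cast
    have hi := integrable_braket f f
    simp only [h] at hi
    refine ⟨?_, hi.norm.congr (Eventually.of_forall fun y => by simp)⟩
    simp only [braket, h]
    rw [integral_complex_ofReal, Complex.ofReal_re]
  obtain ⟨h1, hi1⟩ := hre f
  obtain ⟨h2, hi2⟩ := hre (momOp f)
  have hnorm : ∀ y, ‖momOp f y‖ = ‖deriv f y‖ := fun y => by simp [momOp_apply]
  simp only [hnorm] at h2 hi2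
  have hd : ∀ y, HasDerivAt (fun y => star (f y) * f y)
      (star (deriv f y) * f y + star (f y) * deriv f y) y := fun y =>
    ((Complex.conjCLE : ℂ →L[ℝ] ℂ).hasFDerivAt.comp_hasDerivAt y (f.hasDerivAt y)).mul
      (f.hasDerivAt y)
  have hint : Integrable fun y => star (deriv f y) * f y + star (f y) * deriv f y := by
    have h3 := integrable_braket (SchwartzMap.derivCLM ℂ ℂ f) f
    have h4 := integrable_braket f (SchwartzMap.derivCLM ℂ ℂ f)
    simp only [SchwartzMap.derivCLM_apply] at h3 h4
    exact h3.add h4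
  have hlim := tendsto_zero_of_hasDerivAt_of_integrableOn_Iic (a := x) (fun y _ => hd y)
    hint.integrableOn (integrable_braket f f).integrableOn
  have key := integral_Iic_of_hasDerivAt_of_tendsto' (fun y (_ : y ∈ Set.Iic x) => hd y)
    hint.integrableOn hlim
  have hfx : ‖f x‖ ^ 2 = ‖star (f x) * f x - 0‖ := by
    rw [sub_zero, norm_mul, norm_star, sq]
  rw [hfx, ← key, h1, h2, ← integral_add hi1 hi2]
  refine (norm_integral_le_integral_norm _).trans ?_
  refine (setIntegral_le_integral hint.norm (Eventually.of_forall fun y => norm_nonneg _)).trans ?_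
  refine integral_mono hint.norm (hi1.add hi2) fun y => ?_
  refine (norm_add_le _ _).trans ?_
  simp only [norm_mul, norm_star]
  nlinarith [sq_nonneg (‖f y‖ - ‖deriv f y‖)]

theorem star_sqrt (r : ℝ) : star ((√r : ℝ) : ℂ) = ((√r : ℝ) : ℂ) := by
  rw [Complex.star_def, Complex.conj_ofReal]

/-- With `P = i(a† - a)/√2`, the cross terms connect levels two apart and vanish; the diagonal ones
give `n` and `n + 1`. -/
theorem braket_momOp_numberState (n : ℕ) :
    braket (momOp (numberState n)) (momOp (numberState n)) = n + 1 / 2 := by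
  have h2 : annihilation (annihilation (numberState n)) =
      (((√(n : ℝ) : ℝ) : ℂ) * ((√((n - 1 : ℕ) : ℝ) : ℝ) : ℂ)) • numberState (n - 2) := by
    rw [annihilation_numberState, map_smul, annihilation_numberState, smul_smul]
    rfl
  have h3 : braket (numberState n) (annihilation (annihilation (numberState n))) = 0 := by
    rw [h2, braket_smul_right, braket_numberState]
    rcases Nat.eq_zero_or_pos n with rfl | hn
    · simp
    · rw [if_neg (by omega), mul_zero]
  have h4 : braket (annihilation (numberState n)) (annihilation (numberState n)) = n := by
    rw [annihilation_numberState, braket_smul_left, braket_smul_right, braket_numberState,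
      if_pos rfl, mul_one, star_sqrt, sqrt_cast_mul_self]
  have h5 : braket (creation (numberState n)) (creation (numberState n)) = n + 1 := by
    have := sqrt_cast_mul_self (n + 1)
    push_cast at this
    rw [creation_numberState, braket_smul_left, braket_smul_right, braket_numberState,
      if_pos rfl, mul_one, star_sqrt, this]
  have h6 : braket (creation (numberState n)) (annihilation (numberState n)) = 0 := by
    rw [← braket_annihilation, h3]
  have h7 : braket (annihilation (numberState n)) (creation (numberState n)) = 0 := by
    rw [← star_braket, h6, star_zero]
  rw [momOp_eq, braket_smul_left, braket_smul_right, braket_sub_left, braket_sub_right,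
    braket_sub_right, h4, h5, h6, h7, star_mul', star_sqrt_two_inv, Complex.star_def,
    Complex.conj_I]
  linear_combination (-(2 * n + 1) * Complex.I ^ 2) * sqrt_two_inv_mul_self
    - (n + 1 / 2 : ℂ) * Complex.I_sq

/-- The Sobolev bound gives `n + 3/2` for the square; the estimate is crude because only polynomial
growth matters. -/
theorem norm_numberState_le (n : ℕ) (x : ℝ) : ‖numberState n x‖ ≤ 2 * (n + 1) := by
  have h := norm_sq_apply_le (numberState n) x
  rw [braket_momOp_numberState, braket_numberState, if_pos rfl] at h
  have h1 : ((n : ℂ) + 1 / 2).re = n + 1 / 2 := by simp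
  rw [h1, Complex.one_re] at h
  have hn : (0 : ℝ) ≤ n := n.cast_nonneg
  refine le_of_sq_le_sq ?_ (by positivity)
  nlinarith

/-- The functions `T |n⟩` grow at most polynomially in `n`, uniformly on the line. -/
def HasPolyGrowth (T : 𝓢(ℝ, ℂ) →L[ℂ] 𝓢(ℝ, ℂ)) : Prop :=
  ∃ C : ℝ, 0 ≤ C ∧ ∃ r : ℕ, ∀ (n : ℕ) (x : ℝ), ‖T (numberState n) x‖ ≤ C * (n + 1) ^ r

theorem HasPolyGrowth.smul {T : 𝓢(ℝ, ℂ) →L[ℂ] 𝓢(ℝ, ℂ)} (hT : HasPolyGrowth T) (c : ℂ) :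
    HasPolyGrowth (c • T) := by
  obtain ⟨C, hC, r, h⟩ := hT
  refine ⟨‖c‖ * C, by positivity, r, fun n x => ?_⟩
  rw [smul_apply, smul_apply, norm_smul, mul_assoc]
  exact mul_le_mul_of_nonneg_left (h n x) (norm_nonneg _)

theorem HasPolyGrowth.add {S T : 𝓢(ℝ, ℂ) →L[ℂ] 𝓢(ℝ, ℂ)} (hS : HasPolyGrowth S)
    (hT : HasPolyGrowth T) : HasPolyGrowth (S + T) := by
  obtain ⟨C, hC, r, h⟩ := hS
  obtain ⟨D, hD, t, k⟩ := hT
  refine ⟨C + D, by positivity, r + t, fun n x => ?_⟩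
  have hn : (1 : ℝ) ≤ n + 1 := by linarith [(n.cast_nonneg : (0 : ℝ) ≤ n)]
  have h1 : ((n : ℝ) + 1) ^ r ≤ (n + 1) ^ (r + t) := pow_le_pow_right₀ hn (by omega)
  have h2 : ((n : ℝ) + 1) ^ t ≤ (n + 1) ^ (r + t) := pow_le_pow_right₀ hn (by omega)
  rw [add_apply, add_apply, add_mul]
  exact (norm_add_le _ _).trans (add_le_add ((h n x).trans (by gcongr)) ((k n x).trans (by gcongr)))

theorem HasPolyGrowth.comp_creation {T : 𝓢(ℝ, ℂ) →L[ℂ] 𝓢(ℝ, ℂ)} (hT : HasPolyGrowth T) :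
    HasPolyGrowth (T.comp creation) := by
  obtain ⟨C, hC, r, h⟩ := hT
  refine ⟨C * 2 ^ r, by positivity, r + 1, fun n x => ?_⟩
  have hn : (0 : ℝ) ≤ n := n.cast_nonneg
  have h1 : √((n : ℝ) + 1) ≤ n + 1 := Real.sqrt_le_iff.2 ⟨by positivity, by nlinarith⟩
  have h2 := h (n + 1) x
  have h3 : ((n + 1 : ℕ) + 1 : ℝ) ^ r ≤ (2 * (n + 1)) ^ r := by
    gcongr
    push_cast
    linarith
  rw [ContinuousLinearMap.comp_apply, creation_numberState, map_smul, smul_apply, norm_smul,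
    Complex.norm_real, Real.norm_of_nonneg (Real.sqrt_nonneg _)]
  calc √((n : ℝ) + 1) * ‖T (numberState (n + 1)) x‖ ≤ (n + 1) * (C * (2 * (n + 1)) ^ r) := by
        gcongr
        exact h2.trans (by gcongr)
    _ = C * 2 ^ r * (n + 1) ^ (r + 1) := by rw [mul_pow]; ring

theorem HasPolyGrowth.comp_annihilation {T : 𝓢(ℝ, ℂ) →L[ℂ] 𝓢(ℝ, ℂ)} (hT : HasPolyGrowth T) :
    HasPolyGrowth (T.comp annihilation) := by
  obtain ⟨C, hC, r, h⟩ := hT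
  refine ⟨C, hC, r + 1, fun n x => ?_⟩
  have hn : (0 : ℝ) ≤ n := n.cast_nonneg
  have h1 : √(n : ℝ) ≤ n + 1 := Real.sqrt_le_iff.2 ⟨by positivity, by nlinarith⟩
  have h2 := h (n - 1) x
  have h3 : ((n - 1 : ℕ) + 1 : ℝ) ^ r ≤ (n + 1) ^ r := by
    gcongr
    omega
  rw [ContinuousLinearMap.comp_apply, annihilation_numberState, map_smul, smul_apply, norm_smul,
    Complex.norm_real, Real.norm_of_nonneg (Real.sqrt_nonneg _)]
  calc √(n : ℝ) * ‖T (numberState (n - 1)) x‖ ≤ (n + 1) * (C * (n + 1) ^ r) := by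
        gcongr
        exact h2.trans (by gcongr)
    _ = C * (n + 1) ^ (r + 1) := by ring

theorem HasPolyGrowth.comp_posOp {T : 𝓢(ℝ, ℂ) →L[ℂ] 𝓢(ℝ, ℂ)} (hT : HasPolyGrowth T) :
    HasPolyGrowth (T.comp posOp) := by
  have h : T.comp posOp =
      ((√2 : ℝ) : ℂ)⁻¹ • (T.comp creation + T.comp annihilation) := by
    ext1 f
    simp [posOp_eq]
  rw [h]
  exact (hT.comp_creation.add hT.comp_annihilation).smul _

theorem derivCLM_eq (f : 𝓢(ℝ, ℂ)) : SchwartzMap.derivCLM ℂ ℂ f =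
    ((√2 : ℝ) : ℂ)⁻¹ • (annihilation f + (-1 : ℂ) • creation f) := by
  ext x
  simp only [SchwartzMap.derivCLM_apply, smul_apply, add_apply, creation_apply,
    annihilation_apply, smul_eq_mul]
  linear_combination (-2 * deriv f x) * sqrt_two_inv_mul_self

theorem HasPolyGrowth.comp_derivCLM {T : 𝓢(ℝ, ℂ) →L[ℂ] 𝓢(ℝ, ℂ)} (hT : HasPolyGrowth T) :
    HasPolyGrowth (T.comp (SchwartzMap.derivCLM ℂ ℂ)) := by
  have h : T.comp (SchwartzMap.derivCLM ℂ ℂ) =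
      ((√2 : ℝ) : ℂ)⁻¹ • (T.comp annihilation + (-1 : ℂ) • T.comp creation) := by
    ext1 f
    simp [derivCLM_eq]
  rw [h]
  exact (hT.comp_annihilation.add (hT.comp_creation.smul _)).smul _

theorem posOp_pow_apply (k : ℕ) (f : 𝓢(ℝ, ℂ)) (x : ℝ) : (posOp ^ k) f x = x ^ k * f x := by
  induction k generalizing f with
  | zero => simp
  | succ k ih =>
    rw [pow_succ, mul_apply_eq_comp, ih, posOp_apply]
    ring

theorem derivCLM_pow_apply (l : ℕ) (f : 𝓢(ℝ, ℂ)) (x : ℝ) :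
    (SchwartzMap.derivCLM ℂ ℂ ^ l) f x = iteratedDeriv l f x := by
  induction l generalizing f with
  | zero => simp
  | succ l ih =>
    rw [pow_succ, mul_apply_eq_comp, ih, iteratedDeriv_succ']
    congr 1

/-- Position and derivative are combinations of `a` and `a†`, each of which shifts the level by one
at the cost of a factor at most `n + 1`, so composing on the right preserves polynomial growth. -/
theorem seminorm_numberState_le (k l : ℕ) : ∃ C : ℝ, 0 ≤ C ∧ ∃ r : ℕ, ∀ n : ℕ,
    SchwartzMap.seminorm ℂ k l (numberState n) ≤ C * (n + 1) ^ r := by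
  have h : HasPolyGrowth (posOp ^ k * SchwartzMap.derivCLM ℂ ℂ ^ l) := by
    induction l with
    | zero =>
      induction k with
      | zero => exact ⟨2, by norm_num, 1, fun n x => by simpa using norm_numberState_le n x⟩
      | succ k ih =>
        rw [pow_zero, mul_one] at ih ⊢
        exact ih.comp_posOp
    | succ l ih => exact ih.comp_derivCLM
  obtain ⟨C, hC, r, h⟩ := h
  refine ⟨C, hC, r, fun n => SchwartzMap.seminorm_le_bound' ℂ k l _ (by positivity) fun x => ?_⟩
  refine le_of_eq_of_le ?_ (h n x)
  rw [mul_apply_eq_comp, posOp_pow_apply, derivCLM_pow_apply, norm_mul, norm_pow,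
    Complex.norm_real, Real.norm_eq_abs]

theorem norm_braket_le (f g : 𝓢(ℝ, ℂ)) {M : ℝ} (hM : ∀ x, ‖f x‖ ≤ M) :
    ‖braket f g‖ ≤ M * ∫ x, ‖g x‖ := by
  rw [← integral_const_mul]
  refine norm_integral_le_of_norm_le (g.integrable.norm.const_mul M)
    (Eventually.of_forall fun x => ?_)
  rw [norm_mul, norm_star]
  exact mul_le_mul_of_nonneg_right (hM x) (norm_nonneg _)

/-- As `a a†` is symmetric with eigenvalue `n + 1` on `|n⟩`, powers of it can be moved onto `f`,
which yields rapid decay. -/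
theorem norm_braket_numberState_le (f : 𝓢(ℝ, ℂ)) (r : ℕ) :
    ∃ C : ℝ, 0 ≤ C ∧ ∀ n : ℕ, ‖braket (numberState n) f‖ * (n + 1) ^ r ≤ C := by
  have hN : ∀ (n : ℕ) (f : 𝓢(ℝ, ℂ)),
      braket (numberState n) (annihilation (creation f)) = (n + 1) * braket (numberState n) f := by
    intro n f
    have := sqrt_cast_mul_self (n + 1)
    push_cast at this
    rw [braket_annihilation, braket_creation, creation_numberState, map_smul,
      annihilation_numberState_succ, smul_smul, this, braket_smul_left]
    simp
  have hNr : ∀ (r n : ℕ), braket (numberState n) (((annihilation * creation) ^ r) f) =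
      (n + 1) ^ r * braket (numberState n) f := by
    intro r n
    induction r with
    | zero => simp
    | succ r ih =>
      rw [pow_succ', mul_apply_eq_comp, mul_apply_eq_comp, hN, ih, pow_succ']
      ring
  -- One power more than `r`, to absorb the sup bound `2(n + 1)` of the number state.
  set h := ((annihilation * creation) ^ (r + 1)) f with hh
  refine ⟨2 * ∫ x, ‖h x‖, by positivity, fun n => ?_⟩
  have hn : (0 : ℝ) < n + 1 := by positivity
  have h1 := norm_braket_le (numberState n) h (norm_numberState_le n)
  have h2 : ‖((n : ℂ) + 1) ^ (r + 1)‖ = ((n : ℝ) + 1) ^ (r + 1) := by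
    rw [norm_pow]
    congr 1
    exact_mod_cast Complex.norm_natCast (n + 1)
  rw [hh, hNr, norm_mul, ← hh, h2] at h1
  refine le_of_mul_le_mul_left ?_ hn
  calc ((n : ℝ) + 1) * (‖braket (numberState n) f‖ * (n + 1) ^ r)
      = (n + 1) ^ (r + 1) * ‖braket (numberState n) f‖ := by ring
    _ ≤ _ := h1
    _ = _ := by ring

/-- Weierstrass test for all derivatives at once. The seminorm estimate of the sum is kept because
it will be applied to tails. -/
theorem exists_hasSum_apply (f : ℕ → 𝓢(ℝ, ℂ))
    (hf : ∀ k l : ℕ, Summable fun n => SchwartzMap.seminorm ℂ k l (f n)) :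
    ∃ S : 𝓢(ℝ, ℂ), (∀ x, HasSum (fun n => f n x) (S x)) ∧
      ∀ k l : ℕ, SchwartzMap.seminorm ℂ k l S ≤ ∑' n, SchwartzMap.seminorm ℂ k l (f n) := by
  have hv : ∀ k : ℕ, (k : ℕ∞) ≤ ⊤ → Summable fun n => SchwartzMap.seminorm ℂ 0 k (f n) :=
    fun k _ => hf 0 k
  have hb : ∀ (k n : ℕ) (x : ℝ), (k : ℕ∞) ≤ ⊤ →
      ‖iteratedFDeriv ℝ k (f n) x‖ ≤ SchwartzMap.seminorm ℂ 0 k (f n) :=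
    fun k n x _ => SchwartzMap.norm_iteratedFDeriv_le_seminorm ℂ (f n) k x
  have hs : ∀ n, ContDiff ℝ ((⊤ : ℕ∞) : WithTop ℕ∞) (f n) := fun n => (f n).smooth ⊤
  have hbound : ∀ (k l : ℕ) (x : ℝ), ‖x‖ ^ k * ‖iteratedFDeriv ℝ l (fun y => ∑' n, f n y) x‖ ≤
      ∑' n, SchwartzMap.seminorm ℂ k l (f n) := by
    intro k l x
    rw [iteratedFDeriv_tsum hs hv hb le_top]
    have h1 : Summable fun n => ‖iteratedFDeriv ℝ l (f n) x‖ :=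
      Summable.of_nonneg_of_le (fun n => norm_nonneg _) (fun n => hb l n x le_top) (hf 0 l)
    refine (mul_le_mul_of_nonneg_left (norm_tsum_le_tsum_norm h1) (by positivity)).trans ?_
    rw [← tsum_mul_left]
    exact Summable.tsum_le_tsum (fun n => SchwartzMap.le_seminorm ℂ k l (f n) x)
      (h1.mul_left _) (hf k l)
  refine ⟨⟨fun y => ∑' n, f n y, contDiff_tsum hs hv hb, fun k l => ⟨_, hbound k l⟩⟩, fun x => ?_,
    fun k l => SchwartzMap.seminorm_le_bound ℂ k l _
      (tsum_nonneg fun n => apply_nonneg _ _) (hbound k l)⟩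
  exact (Summable.of_norm_bounded (hf 0 0)
    fun n => SchwartzMap.norm_le_seminorm ℂ (f n) x).hasSum

theorem summable_of_summable_seminorm (f : ℕ → 𝓢(ℝ, ℂ))
    (hf : ∀ k l : ℕ, Summable fun n => SchwartzMap.seminorm ℂ k l (f n)) : Summable f := by
  obtain ⟨S, hS, -⟩ := exists_hasSum_apply f hf
  refine ⟨S, ?_⟩
  rw [HasSum, (schwartz_withSeminorms ℂ ℝ ℂ).tendsto_nhds]
  rintro ⟨k, l⟩ ε hε
  have htail := (tendsto_order.1 (tendsto_tsum_compl_atTop_zero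
    fun n => SchwartzMap.seminorm ℂ k l (f n))).2 ε hε
  filter_upwards [htail] with s hs
  classical
  -- The tail beyond `s` is itself a series of the same kind, so its seminorms are bounded by the
  -- tail of the numerical series.
  set g : ℕ → 𝓢(ℝ, ℂ) := fun n => if n ∈ s then 0 else f n with hg
  have hle : ∀ k l n, SchwartzMap.seminorm ℂ k l (g n) ≤ SchwartzMap.seminorm ℂ k l (f n) := by
    intro k l n
    by_cases hn : n ∈ s <;> simp [hg, hn]
  obtain ⟨R, hR, hRb⟩ := exists_hasSum_apply g fun k l =>
    Summable.of_nonneg_of_le (fun n => apply_nonneg _ _) (hle k l) (hf k l)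
  have hSR : ∑ n ∈ s, f n - S = -R := by
    ext x
    have h1 : HasSum (fun n => f n x - g n x) (S x - R x) := (hS x).sub (hR x)
    have h2 : HasSum (fun n => f n x - g n x) (∑ n ∈ s, (f n x - g n x)) := by
      refine hasSum_sum_of_ne_finset_zero fun n hn => ?_
      simp [hg, hn]
    have h3 : ∑ n ∈ s, (f n x - g n x) = ∑ n ∈ s, f n x := by
      refine Finset.sum_congr rfl fun n hn => ?_
      simp [hg, hn]
    have h4 := h1.unique h2
    rw [h3] at h4
    rw [sub_apply, neg_apply, sum_apply, ← h4]
    ring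
  rw [SchwartzMap.schwartzSeminormFamily_apply, hSR, map_neg_eq_map]
  refine ((hRb k l).trans_eq ?_).trans_lt hs
  refine Eq.trans ?_ (tsum_subtype {n | n ∉ s} fun n => SchwartzMap.seminorm ℂ k l (f n)).symm
  refine tsum_congr fun n => ?_
  by_cases hn : n ∈ s <;> simp [hg, hn]

theorem summable_numberRotationTerm (θ : ℝ) (f : 𝓢(ℝ, ℂ)) : Summable (numberRotationTerm θ f) := by
  refine summable_of_summable_seminorm _ fun k l => ?_
  obtain ⟨C, hC, r, h⟩ := seminorm_numberState_le k l
  -- The growth exponent `r` is cancelled and two more powers leave terms of order `n⁻²`.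
  obtain ⟨D, hD, h'⟩ := norm_braket_numberState_le f (r + 2)
  have hsum : Summable fun n : ℕ => C * D * ((n + 1 : ℕ) ^ 2 : ℝ)⁻¹ :=
    ((summable_nat_add_iff 1).2 (Real.summable_nat_pow_inv.2 one_lt_two)).mul_left _
  refine Summable.of_nonneg_of_le (fun n => apply_nonneg _ _) (fun n => ?_) hsum
  have hn : (0 : ℝ) < n + 1 := by positivity
  have he : ‖Complex.exp (Complex.I * θ * n)‖ = 1 := by
    rw [show Complex.I * θ * n = ((θ * n : ℝ) : ℂ) * Complex.I by push_cast; ring,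
      Complex.norm_exp_ofReal_mul_I]
  rw [numberRotationTerm, map_smul_eq_mul, norm_mul, he, one_mul]
  push_cast
  rw [← div_eq_mul_inv, le_div_iff₀ (by positivity)]
  calc ‖braket (numberState n) f‖ * SchwartzMap.seminorm ℂ k l (numberState n) * (n + 1) ^ 2
      ≤ ‖braket (numberState n) f‖ * (C * (n + 1) ^ r) * (n + 1) ^ 2 := by
        gcongr
        exact h n
    _ = C * (‖braket (numberState n) f‖ * (n + 1) ^ (r + 2)) := by ring
    _ ≤ C * D := by
        gcongr
        exact h' n

/-! ### Completeness of the number states. -/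

theorem posOp_mem_span {f : 𝓢(ℝ, ℂ)} (hf : f ∈ Submodule.span ℂ (Set.range numberState)) :
    posOp f ∈ Submodule.span ℂ (Set.range numberState) := by
  induction hf using Submodule.span_induction with
  | mem f hf =>
    obtain ⟨n, rfl⟩ := hf
    have h : ∀ n, numberState n ∈ Submodule.span ℂ (Set.range numberState) := fun n =>
      Submodule.subset_span ⟨n, rfl⟩
    rw [posOp_eq, creation_numberState, annihilation_numberState]
    exact Submodule.smul_mem _ _ (Submodule.add_mem _ (Submodule.smul_mem _ _ (h _))
      (Submodule.smul_mem _ _ (h _)))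
  | zero => simp
  | add f g _ _ hf hg => simpa using Submodule.add_mem _ hf hg
  | smul c f _ hf => simpa using Submodule.smul_mem _ c hf

theorem braket_eq_zero_of_mem_span {f g : 𝓢(ℝ, ℂ)} (hg : ∀ n, braket (numberState n) g = 0)
    (hf : f ∈ Submodule.span ℂ (Set.range numberState)) : braket f g = 0 := by
  induction hf using Submodule.span_induction with
  | mem f hf =>
    obtain ⟨n, rfl⟩ := hf
    exact hg n
  | zero => exact braket_zero_left _
  | add f h _ _ hf hh => rw [braket_add_left, hf, hh, add_zero]
  | smul c f _ hf => rw [braket_smul_left, hf, mul_zero]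

theorem star_gaussian (x : ℝ) : star (gaussian x) = gaussian x := by
  rw [gaussian_apply, Complex.star_def, Complex.conj_ofReal]

theorem integral_pow_mul_gaussian_mul_eq_zero {f : 𝓢(ℝ, ℂ)}
    (hf : ∀ n, braket (numberState n) f = 0) (k : ℕ) :
    ∫ x : ℝ, (x : ℂ) ^ k * (gaussian x * f x) = 0 := by
  have h0 : (Real.pi ^ (-(1 / 4) : ℝ) : ℝ) ≠ 0 := by positivity
  have h1 : (posOp ^ k) (numberState 0) ∈ Submodule.span ℂ (Set.range numberState) := by
    induction k with
    | zero => exact Submodule.subset_span ⟨0, rfl⟩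
    | succ k ih =>
      rw [pow_succ', mul_apply_eq_comp]
      exact posOp_mem_span ih
  have h2 := braket_eq_zero_of_mem_span hf h1
  have h3 : ∀ x : ℝ, star ((posOp ^ k) (numberState 0) x) * f x =
      ((Real.pi ^ (-(1 / 4) : ℝ) : ℝ) : ℂ) * ((x : ℂ) ^ k * (gaussian x * f x)) := by
    intro x
    have h4 : numberState 0 x = ((Real.pi ^ (-(1 / 4) : ℝ) : ℝ) : ℂ) * gaussian x := by
      simp [numberState]
    rw [posOp_pow_apply, h4, star_mul', star_mul', star_gaussian, star_pow]
    simp only [Complex.star_def, Complex.conj_ofReal]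
    ring
  rw [braket, integral_congr_ae (Eventually.of_forall h3), integral_const_mul] at h2
  exact (mul_eq_zero.1 h2).resolve_left (Complex.ofReal_ne_zero.2 h0)

/-- All moments of the Gaussian times `f` vanish. Expanding the exponential in its Fourier transform
and integrating termwise shows that this transform is zero, hence so is `f`. -/
theorem eq_zero_of_forall_braket_numberState {f : 𝓢(ℝ, ℂ)}
    (hf : ∀ n, braket (numberState n) f = 0) : f = 0 := by
  set h : 𝓢(ℝ, ℂ) := SchwartzMap.smulLeftCLM ℂ gaussian f with hh
  have happ : ∀ x, h x = gaussian x * f x := fun x => by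
    rw [hh, SchwartzMap.smulLeftCLM_apply_apply gaussian.hasTemperateGrowth, smul_eq_mul]
  have hF : FourierTransform.fourier h = 0 := by
    ext t
    rw [SchwartzMap.fourier_coe, Real.fourier_real_eq_integral_exp_smul, zero_apply]
    obtain ⟨c, hc⟩ : ∃ c : ℂ, c = ((-2 * Real.pi * t : ℝ) : ℂ) * Complex.I := ⟨_, rfl⟩
    have hexp : ∀ x : ℝ, Complex.exp (((-2 * Real.pi * x * t : ℝ) : ℂ) * Complex.I) • h x =
        Complex.exp (c * x) * (gaussian x * f x) := by
      intro x
      rw [happ, smul_eq_mul, hc]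
      congr 2
      push_cast
      ring
    simp only [hexp]
    have hbsum : ∀ x : ℝ, HasSum (fun n : ℕ => (‖c‖ * |x|) ^ n / n.factorial *
        ‖gaussian x * f x‖) (Real.exp (‖c‖ * |x|) * ‖gaussian x * f x‖) := by
      intro x
      have := NormedSpace.expSeries_div_hasSum_exp (𝔸 := ℝ) (‖c‖ * |x|)
      rw [← Real.exp_eq_exp_ℝ] at this
      exact this.mul_right _
    -- The Gaussian absorbs the exponential: `‖c‖|x| - x²/2 ≤ ‖c‖²/2`. This dominates the
    -- exponential series.
    have hle : ∀ x : ℝ, Real.exp (‖c‖ * |x|) * ‖gaussian x * f x‖ ≤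
        Real.exp (‖c‖ ^ 2 / 2) * ‖f x‖ := by
      intro x
      rw [norm_mul, ← mul_assoc, gaussian_apply, Complex.norm_real,
        Real.norm_of_nonneg (Real.exp_pos _).le, ← Real.exp_add]
      gcongr
      nlinarith [sq_nonneg (‖c‖ - |x|), sq_abs x]
    have hmeas : ∀ g : ℝ → ℂ, Continuous g → AEStronglyMeasurable g volume := fun g hg =>
      hg.aestronglyMeasurable
    have key := hasSum_integral_of_dominated_convergence (μ := volume)
      (F := fun (n : ℕ) (x : ℝ) => (c * x) ^ n / n.factorial * (gaussian x * f x))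
      (f := fun x : ℝ => Complex.exp (c * x) * (gaussian x * f x))
      (fun (n : ℕ) (x : ℝ) => (‖c‖ * |x|) ^ n / n.factorial * ‖gaussian x * f x‖)
      (fun n => hmeas _ (by fun_prop))
      (fun n => Eventually.of_forall fun x => by simp)
      (Eventually.of_forall fun x => (hbsum x).summable)
      (by
        simp only [fun x => (hbsum x).tsum_eq]
        refine (f.integrable.norm.const_mul (Real.exp (‖c‖ ^ 2 / 2))).mono'
          (Continuous.aestronglyMeasurable (by fun_prop)) (Eventually.of_forall fun x => ?_)
        rw [Real.norm_of_nonneg (by positivity)]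
        exact hle x)
      (Eventually.of_forall fun x => by
        have := NormedSpace.expSeries_div_hasSum_exp (𝔸 := ℂ) (c * x)
        rw [← Complex.exp_eq_exp_ℂ] at this
        exact this.mul_right _)
    have hzero : ∀ n : ℕ, ∫ x : ℝ, (c * x) ^ n / n.factorial * (gaussian x * f x) = 0 := by
      intro n
      have : ∀ x : ℝ, (c * x) ^ n / n.factorial * (gaussian x * f x) =
          c ^ n / n.factorial * ((x : ℂ) ^ n * (gaussian x * f x)) := fun x => by
        rw [mul_pow]
        ring
      simp only [this]
      rw [integral_const_mul, integral_pow_mul_gaussian_mul_eq_zero hf, mul_zero]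
    simp only [hzero] at key
    exact key.unique hasSum_zero
  have hz : h = 0 := by
    have h1 := FourierTransform.fourierInv_fourier_eq (F := 𝓢(ℝ, ℂ)) h
    rw [hF] at h1
    rw [← h1]
    exact map_zero (FourierTransform.fourierInvCLM ℂ 𝓢(ℝ, ℂ))
  ext x
  have hx := happ x
  rw [hz, zero_apply] at hx
  refine (mul_eq_zero.1 hx.symm).resolve_left ?_
  rw [gaussian_apply, Complex.ofReal_eq_zero]
  exact (Real.exp_pos _).ne'

theorem ext_braket_numberState {f g : 𝓢(ℝ, ℂ)}
    (h : ∀ n, braket (numberState n) f = braket (numberState n) g) : f = g := by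
  refine sub_eq_zero.1 (eq_zero_of_forall_braket_numberState fun n => ?_)
  rw [braket_sub_right, h, sub_self]

/-! ### The rotations `e^{iθN}`. -/

theorem hasSum_numberRotation (θ : ℝ) (f : 𝓢(ℝ, ℂ)) :
    HasSum (numberRotationTerm θ f) (numberRotation θ f) :=
  (summable_numberRotationTerm θ f).hasSum

theorem braket_numberRotation (θ : ℝ) (f : 𝓢(ℝ, ℂ)) (n : ℕ) :
    braket (numberState n) (numberRotation θ f) =
      Complex.exp (Complex.I * θ * n) * braket (numberState n) f := by
  have h := (hasSum_numberRotation θ f).mapL (braketCLM (numberState n))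
  refine (braketCLM_apply _ _).symm.trans (h.unique ?_)
  have h1 : ∀ m, braketCLM (numberState n) (numberRotationTerm θ f m) =
      if m = n then Complex.exp (Complex.I * θ * n) * braket (numberState n) f else 0 := by
    intro m
    rw [braketCLM_apply, numberRotationTerm, braket_smul_right, braket_numberState]
    by_cases hm : m = n
    · subst hm
      simp
    · simp [hm, Ne.symm hm]
  simp only [h1]
  exact hasSum_ite_eq n _

theorem numberRotation_zero (f : 𝓢(ℝ, ℂ)) : numberRotation 0 f = f :=
  ext_braket_numberState fun n => by simp [braket_numberRotation]

theorem numberRotation_numberRotation (θ θ' : ℝ) (f : 𝓢(ℝ, ℂ)) :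
    numberRotation θ (numberRotation θ' f) = numberRotation (θ + θ') f :=
  ext_braket_numberState fun n => by
    rw [braket_numberRotation, braket_numberRotation, braket_numberRotation, ← mul_assoc,
      ← Complex.exp_add]
    congr 2
    push_cast
    ring

theorem hasSum_braket_smul_numberState (f : 𝓢(ℝ, ℂ)) :
    HasSum (fun n => braket (numberState n) f • numberState n) f := by
  have h := hasSum_numberRotation 0 f
  rw [numberRotation_zero] at h
  convert h using 2 with n
  simp [numberRotationTerm]

/-- The coefficients satisfy `√(n!) ⟨n|z⟩ = (z/√2)ⁿ e^{-|z|²/4}`, so the phase `e^{iθn}` is absorbed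
in `zⁿ` while `|z|` is unchanged. -/
theorem numberRotation_coherentState (θ : ℝ) (z : ℂ) :
    numberRotation θ (coherentState z) = coherentState (Complex.exp (Complex.I * θ) * z) := by
  have hn : ∀ (n : ℕ) (z : ℂ), (√(n.factorial : ℝ) : ℂ) * braket (numberState n) (coherentState z) =
      (((√2 : ℝ) : ℂ)⁻¹ * z) ^ n * Complex.exp (- z * star z / 4) := by
    intro n z
    induction n with
    | zero =>
      rw [← coherentState_zero, braket_coherentState]
      simp [neg_div]
    | succ n ih =>
      have h0 : ((√(n + 1 : ℝ) : ℝ) : ℂ) ≠ 0 := by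
        rw [Complex.ofReal_ne_zero]
        positivity
      have h1 : star ((√(n + 1 : ℝ) : ℝ) : ℂ)⁻¹ = ((√(n + 1 : ℝ) : ℝ) : ℂ)⁻¹ := by
        rw [← Complex.ofReal_inv, Complex.star_def, Complex.conj_ofReal]
      rw [numberState_succ, braket_smul_left, ← braket_annihilation, annihilation_coherentState,
        braket_smul_right, h1, Nat.factorial_succ, Nat.cast_mul, Nat.cast_succ,
        Real.sqrt_mul (by positivity), pow_succ, mul_right_comm (_ ^ n), ← ih, Complex.ofReal_mul]
      field_simp
  refine ext_braket_numberState fun n => ?_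
  have h0 : ((√(n.factorial : ℝ) : ℝ) : ℂ) ≠ 0 := by
    rw [Complex.ofReal_ne_zero]
    positivity
  have hexp : Complex.exp (Complex.I * θ) * star (Complex.exp (Complex.I * θ)) = 1 := by
    rw [Complex.star_def, ← Complex.exp_conj, ← Complex.exp_add]
    simp
  refine mul_left_cancel₀ h0 ?_
  rw [braket_numberRotation, mul_left_comm, hn, hn, star_mul', mul_comm (Complex.I * θ),
    Complex.exp_nat_mul, ← mul_assoc, ← mul_pow]
  congr 2
  · ring
  · linear_combination (z * star z / 4) * hexp

/-! ### Eigenfunctionals of the quadratures. -/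

/-- The rotated position operator `Q_θ = Q cos θ + P sin θ`. -/
def quadratureOp (θ : ℝ) : 𝓢(ℝ, ℂ) →L[ℂ] 𝓢(ℝ, ℂ) :=
  (Real.cos θ : ℂ) • posOp + (Real.sin θ : ℂ) • momOp

theorem quadratureOp_eq (θ : ℝ) (f : 𝓢(ℝ, ℂ)) : quadratureOp θ f = ((√2 : ℝ) : ℂ)⁻¹ •
    (Complex.exp (Complex.I * θ) • creation f +
      Complex.exp (-(Complex.I * θ)) • annihilation f) := by
  have h1 : Complex.exp (Complex.I * θ) = Real.cos θ + Real.sin θ * Complex.I := by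
    rw [mul_comm, Complex.exp_mul_I, Complex.ofReal_cos, Complex.ofReal_sin]
  have h2 : Complex.exp (-(Complex.I * θ)) = Real.cos θ - Real.sin θ * Complex.I := by
    rw [← mul_neg, mul_comm, Complex.exp_mul_I, Complex.cos_neg, Complex.sin_neg,
      Complex.ofReal_cos, Complex.ofReal_sin]
    ring
  rw [quadratureOp, add_apply, smul_apply, smul_apply, posOp_eq, momOp_eq, h1, h2]
  module

theorem quadratureOp_numberState (θ : ℝ) (n : ℕ) :
    quadratureOp θ (numberState n) = ((√2 : ℝ) : ℂ)⁻¹ •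
      ((Complex.exp (Complex.I * θ) * ((√(n + 1 : ℝ) : ℝ) : ℂ)) • numberState (n + 1) +
        (Complex.exp (-(Complex.I * θ)) * ((√(n : ℝ) : ℝ) : ℂ)) • numberState (n - 1)) := by
  rw [quadratureOp_eq, creation_numberState, annihilation_numberState, smul_smul, smul_smul]

/-- The values `φₙ(s)` of the number states satisfy the recurrence with `u = v = 1`, hence `vⁿ
φₙ(s)` satisfies the given one. The coefficient of `L (n + 1)` is nonzero, so the value at `0`
determines the solution. The factor `φ₀(s)` avoids a division. -/
theorem eq_of_three_term_recurrence {L : ℕ → ℂ} {u v : ℂ} (huv : u * v = 1) (s : ℝ)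
    (hL : ∀ n : ℕ, ((√2 : ℝ) : ℂ)⁻¹ * (u * ((√(n + 1 : ℝ) : ℝ) : ℂ) * L (n + 1) +
      v * ((√(n : ℝ) : ℝ) : ℂ) * L (n - 1)) = s * L n) (n : ℕ) :
    L n * numberState 0 s = v ^ n * numberState n s * L 0 := by
  have hφ : ∀ n : ℕ, ((√2 : ℝ) : ℂ)⁻¹ * (((√(n + 1 : ℝ) : ℝ) : ℂ) * numberState (n + 1) s +
      ((√(n : ℝ) : ℝ) : ℂ) * numberState (n - 1) s) = s * numberState n s := by
    intro n
    rw [← posOp_apply, posOp_eq, creation_numberState, annihilation_numberState]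
    simp [mul_add]
  induction n using Nat.strong_induction_on with
  | _ n ih =>
    cases n with
    | zero => simp [mul_comm]
    | succ n =>
      have h0 : ((√2 : ℝ) : ℂ)⁻¹ * (u * ((√(n + 1 : ℝ) : ℝ) : ℂ)) ≠ 0 := by
        refine mul_ne_zero (inv_ne_zero ?_) (mul_ne_zero (left_ne_zero_of_mul_eq_one huv) ?_) <;>
        · rw [Complex.ofReal_ne_zero]
          positivity
      have hv : v * ((√(n : ℝ) : ℝ) : ℂ) * v ^ (n - 1) = ((√(n : ℝ) : ℝ) : ℂ) * v ^ n := by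
        cases n with
        | zero => simp
        | succ n =>
          rw [Nat.add_sub_cancel, pow_succ]
          ring
      have h1 := ih n (by omega)
      have h2 := ih (n - 1) (by omega)
      refine mul_left_cancel₀ h0 ?_
      rw [pow_succ]
      linear_combination numberState 0 s * hL n + s * h1 - ((√2 : ℝ) : ℂ)⁻¹ * v *
        ((√(n : ℝ) : ℝ) : ℂ) * h2 - v ^ n * L 0 * hφ n - ((√2 : ℝ) : ℂ)⁻¹ * v ^ n *
        ((√(n + 1 : ℝ) : ℝ) : ℂ) * numberState (n + 1) s * L 0 * huv -
        ((√2 : ℝ) : ℂ)⁻¹ * numberState (n - 1) s * L 0 * hv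

/-- Evaluation at a point as a continuous functional. -/
def evalCLM (s : ℝ) : 𝓢(ℝ, ℂ) →L[ℂ] ℂ :=
  (BoundedContinuousFunction.evalCLM ℂ s).comp (SchwartzMap.toBoundedContinuousFunctionCLM ℂ ℝ ℂ)

theorem evalCLM_apply (s : ℝ) (f : 𝓢(ℝ, ℂ)) : evalCLM s f = f s := rfl

/-- A continuous functional that is an eigenvector of the transpose of `Q_θ` is a multiple of
`⟨s| e^{-i θ N}`. -/
theorem apply_eq_of_quadratureOp_eigen {θ s : ℝ} (l : 𝓢(ℝ, ℂ) →L[ℂ] ℂ)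
    (hl : ∀ g, l (quadratureOp θ g) = s * l g) (g : 𝓢(ℝ, ℂ)) :
    l g * numberState 0 s = numberRotation (-θ) g s * l (numberState 0) := by
  have huv : Complex.exp (Complex.I * θ) * Complex.exp (-(Complex.I * θ)) = 1 := by
    rw [← Complex.exp_add, add_neg_cancel, Complex.exp_zero]
  have hn := eq_of_three_term_recurrence (L := fun n => l (numberState n)) huv s fun n => by
    rw [← hl, quadratureOp_numberState]
    simp only [map_smul, map_add, smul_eq_mul]
  -- Continuity lets `l` act termwise on the number expansion; the factors `vⁿ = e^{-iθn}` are the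
  -- phases of `e^{-iθN}`.
  have h1 := ((hasSum_braket_smul_numberState g).mapL l).mul_right (numberState 0 s)
  have h2 := ((hasSum_numberRotation (-θ) g).mapL (evalCLM s)).mul_right (l (numberState 0))
  refine h1.unique ?_
  rw [evalCLM_apply] at h2
  convert h2 using 2 with n
  rw [evalCLM_apply, numberRotationTerm, map_smul, smul_apply, smul_eq_mul,
    smul_eq_mul, mul_assoc, hn, ← Complex.exp_nat_mul]
  push_cast
  ring_nf

/-! ### The Fourier transform as the rotation by `-π/2`. -/

theorem momAmplitude_eq (p : ℝ) (g : 𝓢(ℝ, ℂ)) : momAmplitude p g =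
    ((√(2 * Real.pi) : ℝ) : ℂ)⁻¹ * ∫ x : ℝ, displacement 0 (-p) g x := by
  rw [momAmplitude]
  congr 1
  refine integral_congr_ae (Eventually.of_forall fun x => ?_)
  simp only [displacement_apply, sub_zero]
  congr 2
  push_cast
  ring

/-- The momentum amplitude as a continuous functional. -/
def momAmplitudeCLM (p : ℝ) : 𝓢(ℝ, ℂ) →L[ℂ] ℂ :=
  ((√(2 * Real.pi) : ℝ) : ℂ)⁻¹ • (SchwartzMap.integralCLM ℂ volume).comp (displacement 0 (-p))

theorem momAmplitudeCLM_apply (p : ℝ) (g : 𝓢(ℝ, ℂ)) : momAmplitudeCLM p g = momAmplitude p g := by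
  rw [momAmplitude_eq]
  rfl

theorem integral_deriv_eq_zero (f : 𝓢(ℝ, ℂ)) : ∫ x, deriv f x = 0 :=
  integral_eq_zero_of_hasDerivAt_of_integrable f.hasDerivAt
    (SchwartzMap.derivCLM ℂ ℂ f).integrable f.integrable

theorem displacement_momOp (q p : ℝ) (f : 𝓢(ℝ, ℂ)) :
    displacement q p (momOp f) = momOp (displacement q p f) - (p : ℂ) • displacement q p f := by
  ext x
  have h1 : HasDerivAt (fun x : ℝ => p * (x - q / 2)) p x := by
    simpa using ((hasDerivAt_id x).sub_const (q / 2)).const_mul p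
  have h2 := (h1.ofReal_comp.const_mul Complex.I).cexp
  have h3 : HasDerivAt (fun x : ℝ => f (x - q)) (deriv f (x - q)) x :=
    HasDerivAt.comp_sub_const x q (f.hasDerivAt (x - q))
  have h4 : (displacement q p f : ℝ → ℂ) = fun x : ℝ =>
      Complex.exp (Complex.I * ((p * (x - q / 2) : ℝ) : ℂ)) * f (x - q) :=
    funext (displacement_apply _ _ f)
  have h5 := (h2.mul h3).deriv
  simp only [Pi.mul_def] at h5
  simp only [displacement_apply, sub_apply, smul_apply, momOp_apply, smul_eq_mul, h4, h5]
  linear_combination (p * Complex.exp (Complex.I * ((p * (x - q / 2) : ℝ) : ℂ)) * f (x - q)) *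
    Complex.I_sq

theorem momAmplitude_momOp (p : ℝ) (f : 𝓢(ℝ, ℂ)) :
    momAmplitude p (momOp f) = p * momAmplitude p f := by
  have h : ∫ x, momOp (displacement 0 (-p) f) x = 0 := by
    simp only [momOp_apply]
    rw [integral_const_mul, integral_deriv_eq_zero, mul_zero]
  rw [momAmplitude_eq, momAmplitude_eq, displacement_momOp]
  simp only [sub_apply, smul_apply]
  rw [integral_sub (SchwartzMap.integrable _) ((SchwartzMap.integrable _).fun_smul _), h,
    integral_smul, smul_eq_mul]
  push_cast
  ring

theorem momAmplitude_numberState_zero (p : ℝ) :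
    momAmplitude p (numberState 0) = numberState 0 p := by
  have h : ∀ x : ℝ, Complex.exp (-(Complex.I * ((p * x : ℝ) : ℂ))) * numberState 0 x =
      ((Real.pi ^ (-(1 / 4) : ℝ) : ℝ) : ℂ) *
        Complex.exp (-(1 / 2) * (x : ℂ) ^ 2 + -(Complex.I * p) * x + 0) := by
    intro x
    rw [numberState_zero_apply, mul_left_comm, ← Complex.exp_add]
    congr 2
    push_cast
    ring
  have hpi : ((Real.pi : ℂ) / -(-(1 / 2))) ^ (1 / 2 : ℂ) = ((√(2 * Real.pi) : ℝ) : ℂ) := by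
    rw [Real.sqrt_eq_rpow, Complex.ofReal_cpow (by positivity)]
    push_cast
    congr 1
    ring
  have h0 : ((√(2 * Real.pi) : ℝ) : ℂ) ≠ 0 := by
    rw [Complex.ofReal_ne_zero]
    positivity
  rw [momAmplitude, integral_congr_ae (Eventually.of_forall h), integral_const_mul,
    integral_cexp_quadratic (by norm_num), hpi, mul_left_comm, inv_mul_cancel_left₀ h0,
    numberState_zero_apply]
  congr 2
  linear_combination (p ^ 2 / 2 : ℂ) * Complex.I_sq

/-- The momentum amplitude is an eigenfunctional of `P = Q_{π/2}`, and the vacuum Gaussian is its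
own Fourier transform, so uniqueness applies with matching constants. -/
theorem momAmplitude_eq_numberRotation (p : ℝ) (f : 𝓢(ℝ, ℂ)) :
    momAmplitude p f = numberRotation (-(Real.pi / 2)) f p := by
  have h := apply_eq_of_quadratureOp_eigen (θ := Real.pi / 2) (s := p) (momAmplitudeCLM p)
    (fun g => by
      rw [momAmplitudeCLM_apply, momAmplitudeCLM_apply, ← momAmplitude_momOp]
      simp [quadratureOp]) f
  rw [momAmplitudeCLM_apply, momAmplitudeCLM_apply, momAmplitude_numberState_zero] at h
  exact mul_right_cancel₀ (numberState_zero_apply_ne_zero p) h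

/-! ### Displaced parity as a reflection of the phase plane. -/

theorem displacedParity_apply (q p : ℝ) (g : 𝓢(ℝ, ℂ)) (x : ℝ) :
    displacedParity q p g x =
      Complex.exp (2 * Complex.I * p * (x - q)) * g (2 * q - x) := by
  rw [displacedParity, ContinuousLinearMap.comp_apply, ContinuousLinearMap.comp_apply,
    displacement_apply, parity_apply, displacement_apply, ← mul_assoc, ← Complex.exp_add]
  congr 2
  · push_cast
    ring
  · ring

theorem norm_displacedParity_apply (q p : ℝ) (g : 𝓢(ℝ, ℂ)) (x : ℝ) :
    ‖displacedParity q p g x‖ = ‖g (2 * q - x)‖ := by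
  have h : 2 * Complex.I * p * (x - q) = ((2 * p * (x - q) : ℝ) : ℂ) * Complex.I := by
    push_cast
    ring
  rw [displacedParity_apply, norm_mul, h, Complex.norm_exp_ofReal_mul_I, one_mul]

theorem braket_parity (f g : 𝓢(ℝ, ℂ)) : braket f (parity g) = braket (parity f) g := by
  rw [braket, ← integral_neg_eq_self]
  simp only [parity_apply, neg_neg]
  rfl

theorem braket_displacedParity (q p : ℝ) (f g : 𝓢(ℝ, ℂ)) :
    braket f (displacedParity q p g) = braket (displacedParity q p f) g := by
  simp only [displacedParity, ContinuousLinearMap.comp_apply]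
  have h := braket_displacement (-q) (-p) (parity (displacement (-q) (-p) f)) g
  rw [neg_neg, neg_neg] at h
  rw [braket_displacement, braket_parity, h]

/-- The point reflection sends `Q` to `2q - Q`. Together with the analogue for `P`, this trades
factors `q`, `p` for operators on the vectors, whence decay in phase space. -/
theorem displacedParity_posOp (q p : ℝ) (g : 𝓢(ℝ, ℂ)) : displacedParity q p (posOp g) =
    (2 * q : ℂ) • displacedParity q p g - posOp (displacedParity q p g) := by
  ext x
  simp only [displacedParity_apply, posOp_apply, sub_apply, smul_apply, smul_eq_mul]
  push_cast
  ring

theorem displacedParity_momOp (q p : ℝ) (g : 𝓢(ℝ, ℂ)) : displacedParity q p (momOp g) =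
    (2 * p : ℂ) • displacedParity q p g - momOp (displacedParity q p g) := by
  have h : ∀ g : 𝓢(ℝ, ℂ), parity (momOp g) = (-1 : ℂ) • momOp (parity g) := by
    intro g
    ext x
    have h1 : deriv (parity g) x = -deriv g (-x) := deriv_comp_neg g x
    simp only [parity_apply, momOp_apply, smul_apply, h1, smul_eq_mul]
    ring
  simp only [displacedParity, ContinuousLinearMap.comp_apply, displacement_momOp, map_sub, map_smul,
    h]
  push_cast
  module

theorem braket_displacedParity_posOp (q p : ℝ) (f g : 𝓢(ℝ, ℂ)) :
    2 * q * braket f (displacedParity q p g) =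
      braket f (displacedParity q p (posOp g)) + braket (posOp f) (displacedParity q p g) := by
  rw [displacedParity_posOp, braket_sub_right, braket_smul_right, braket_posOp]
  ring

theorem braket_displacedParity_momOp (q p : ℝ) (f g : 𝓢(ℝ, ℂ)) :
    2 * p * braket f (displacedParity q p g) =
      braket f (displacedParity q p (momOp g)) + braket (momOp f) (displacedParity q p g) := by
  rw [displacedParity_momOp, braket_sub_right, braket_smul_right, braket_momOp]
  ring

theorem norm_braket_displacedParity_le (q p : ℝ) (f g : 𝓢(ℝ, ℂ)) :
    ‖braket f (displacedParity q p g)‖ ≤ SchwartzMap.seminorm ℂ 0 0 g * ∫ x, ‖f x‖ := by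
  rw [← star_braket, norm_star]
  refine norm_braket_le _ _ fun x => ?_
  rw [norm_displacedParity_apply]
  exact SchwartzMap.norm_le_seminorm ℂ g _

/-- The matrix elements of the Wigner operator decrease quadratically on phase space, with a
constant that depends continuously on the right vector. -/
theorem exists_decay_braket_displacedParity (f : 𝓢(ℝ, ℂ)) :
    ∃ M : 𝓢(ℝ, ℂ) → ℝ, Continuous M ∧ M 0 = 0 ∧ ∀ (q p : ℝ) (g : 𝓢(ℝ, ℂ)),
      (1 + q ^ 2 + p ^ 2) * ‖braket f (displacedParity q p g)‖ ≤ M g := by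
  have hS : Continuous fun g : 𝓢(ℝ, ℂ) => SchwartzMap.seminorm ℂ 0 0 g :=
    (schwartz_withSeminorms ℂ ℝ ℂ).continuous_seminorm (0, 0)
  have key : ∀ T : 𝓢(ℝ, ℂ) →L[ℂ] 𝓢(ℝ, ℂ), ∃ M : 𝓢(ℝ, ℂ) → ℝ, Continuous M ∧ M 0 = 0 ∧
      ∀ (r q p : ℝ) (g : 𝓢(ℝ, ℂ)), (∀ f g : 𝓢(ℝ, ℂ), 2 * r * braket f (displacedParity q p g) =
        braket f (displacedParity q p (T g)) + braket (T f) (displacedParity q p g)) →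
        r ^ 2 * ‖braket f (displacedParity q p g)‖ ≤ M g := by
    intro T
    refine ⟨fun g => SchwartzMap.seminorm ℂ 0 0 (T (T g)) * (∫ x, ‖f x‖) +
      2 * (SchwartzMap.seminorm ℂ 0 0 (T g) * ∫ x, ‖T f x‖) +
      SchwartzMap.seminorm ℂ 0 0 g * ∫ x, ‖T (T f) x‖, ?_, by simp, fun r q p g h => ?_⟩
    · have h1 := hS.comp T.continuous
      have h2 := h1.comp T.continuous
      exact ((h2.mul_const _).add ((h1.mul_const _).const_mul _)).add (hS.mul_const _)
    · have h1 : 4 * (r : ℂ) ^ 2 * braket f (displacedParity q p g) =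
          braket f (displacedParity q p (T (T g))) +
          2 * braket (T f) (displacedParity q p (T g)) +
          braket (T (T f)) (displacedParity q p g) := by
        linear_combination (2 * r : ℂ) * h f g + h f (T g) + h (T f) g
      have h2 : ‖4 * (r : ℂ) ^ 2 * braket f (displacedParity q p g)‖ =
          4 * r ^ 2 * ‖braket f (displacedParity q p g)‖ := by
        rw [norm_mul, norm_mul, norm_pow, Complex.norm_real, Real.norm_eq_abs, sq_abs]
        norm_num
      have h3 : r ^ 2 * ‖braket f (displacedParity q p g)‖ ≤
          4 * r ^ 2 * ‖braket f (displacedParity q p g)‖ := by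
        nlinarith [mul_nonneg (sq_nonneg r) (norm_nonneg (braket f (displacedParity q p g)))]
      refine h3.trans ?_
      rw [← h2, h1]
      refine (norm_add₃_le).trans ?_
      rw [norm_mul, Complex.norm_ofNat]
      exact add_le_add (add_le_add (norm_braket_displacedParity_le _ _ _ _)
        (mul_le_mul_of_nonneg_left (norm_braket_displacedParity_le _ _ _ _) zero_le_two))
        (norm_braket_displacedParity_le _ _ _ _)
  obtain ⟨M, hM, hM0, hMle⟩ := key posOp
  obtain ⟨N, hN, hN0, hNle⟩ := key momOp
  refine ⟨fun g => SchwartzMap.seminorm ℂ 0 0 g * (∫ x, ‖f x‖) + M g + N g,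
    ((hS.mul_const _).add hM).add hN, by simp [hM0, hN0], fun q p g => ?_⟩
  rw [add_mul, add_mul, one_mul]
  exact add_le_add (add_le_add (norm_braket_displacedParity_le _ _ _ _)
    (hMle q q p g fun f g => braket_displacedParity_posOp q p f g))
    (hNle p q p g fun f g => braket_displacedParity_momOp q p f g)

/-! ### Region operators of lines and their factorization. -/

/-- The arc length parametrization of the line `phaseLine θ s`. -/
def linePoint (θ s t : ℝ) : ℂ :=
  ⟨s * Real.cos θ - t * Real.sin θ, s * Real.sin θ + t * Real.cos θ⟩

theorem isometry_linePoint (θ s : ℝ) : Isometry (linePoint θ s) := by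
  refine Isometry.of_dist_eq fun t t' => ?_
  rw [Complex.dist_eq_re_im, Real.dist_eq, ← Real.sqrt_sq_eq_abs]
  congr 1
  simp only [linePoint]
  linear_combination (t - t') ^ 2 * Real.sin_sq_add_cos_sq θ

theorem range_linePoint (θ s : ℝ) : Set.range (linePoint θ s) = phaseLine θ s := by
  ext z
  simp only [Set.mem_range, phaseLine, Set.mem_ofPred_eq]
  constructor
  · rintro ⟨t, rfl⟩
    simp only [linePoint]
    linear_combination s * Real.sin_sq_add_cos_sq θ
  · intro h
    refine ⟨z.im * Real.cos θ - z.re * Real.sin θ, ?_⟩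
    apply Complex.ext <;> simp only [linePoint, ← h]
    · linear_combination z.re * Real.sin_sq_add_cos_sq θ
    · linear_combination z.im * Real.sin_sq_add_cos_sq θ

/-- An isometry carries one-dimensional Hausdorff measure to that of its range, and on `ℝ` this
measure is Lebesgue measure. -/
theorem restrict_phaseLine (θ s : ℝ) : (μH[1] : Measure ℂ).restrict (phaseLine θ s) =
    Measure.map (linePoint θ s) volume := by
  rw [← range_linePoint, ← hausdorffMeasure_real,
    (isometry_linePoint θ s).map_hausdorffMeasure (Or.inl zero_le_one)]

theorem measurableEmbedding_linePoint (θ s : ℝ) : MeasurableEmbedding (linePoint θ s) :=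
  (isometry_linePoint θ s).isClosedEmbedding.measurableEmbedding

/-- The matrix element of the displaced parity at the point with parameter `t` of a line. -/
def lineElement (θ s : ℝ) (f g : 𝓢(ℝ, ℂ)) (t : ℝ) : ℂ :=
  braket f (displacedParity (linePoint θ s t).re (linePoint θ s t).im g)

theorem braket_wigner_linePoint (θ s t : ℝ) (f g : 𝓢(ℝ, ℂ)) :
    braket f (wigner (linePoint θ s t) g) = (Real.pi : ℂ)⁻¹ * lineElement θ s f g t := by
  rw [wigner, smul_apply, braket_smul_right, lineElement]

theorem lineOp_eq (θ s : ℝ) (f g : 𝓢(ℝ, ℂ)) :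
    lineOp θ s f g = (Real.pi : ℂ)⁻¹ * ∫ t, lineElement θ s f g t := by
  rw [lineOp, regionOp, restrict_phaseLine, (measurableEmbedding_linePoint θ s).integral_map,
    ← integral_const_mul]
  simp only [braket_wigner_linePoint]

/-- Motion in the direction `(-sin θ, cos θ)` is generated by `Q_θ`, so the derivative of the
displaced parity `Π_z` is `i[Q_θ, Π_z]`; on the line `Q_θ Π_z = Π_z (2s - Q_θ)`. -/
theorem hasDerivAt_displacedParity_linePoint (θ s t x : ℝ) (g : 𝓢(ℝ, ℂ)) :
    HasDerivAt (fun t => displacedParity (linePoint θ s t).re (linePoint θ s t).im g x)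
      (displacedParity (linePoint θ s t).re (linePoint θ s t).im
        ((2 * Complex.I) • ((s : ℂ) • g - quadratureOp θ g)) x) t := by
  simp only [displacedParity_apply]
  set q := (linePoint θ s t).re with hq
  set p := (linePoint θ s t).im with hp
  have hdq : HasDerivAt (fun t => (linePoint θ s t).re) (-Real.sin θ) t := by
    simpa [linePoint] using ((hasDerivAt_id t).mul_const (Real.sin θ)).const_sub (s * Real.cos θ)
  have hdp : HasDerivAt (fun t => (linePoint θ s t).im) (Real.cos θ) t := by
    simpa [linePoint] using ((hasDerivAt_id t).mul_const (Real.cos θ)).const_add (s * Real.sin θ)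
  have hs : (s : ℂ) = q * Real.cos θ + p * Real.sin θ := by
    have : q * Real.cos θ + p * Real.sin θ = s := by
      simp only [hq, hp, linePoint]
      linear_combination s * Real.sin_sq_add_cos_sq θ
    rw [← this]
    push_cast
    ring
  have h1 := ((hdp.ofReal_comp.const_mul (2 * Complex.I)).mul
    (hdq.ofReal_comp.const_sub (x : ℂ))).cexp
  have h2 := (g.hasDerivAt (2 * q - x)).scomp t ((hdq.const_mul 2).sub_const x)
  refine (h1.mul h2).congr_deriv ?_
  simp only [quadratureOp, add_apply, sub_apply, smul_apply, posOp_apply, momOp_apply, smul_eq_mul,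
    hs, Complex.real_smul, Pi.mul_apply, Function.comp_apply, ← hq, ← hp]
  push_cast
  linear_combination (-2 * Complex.exp (2 * Complex.I * p * (x - q)) * Complex.sin θ *
    deriv g (2 * q - x)) * Complex.I_sq

theorem hasDerivAt_lineElement (θ s t : ℝ) (f g : 𝓢(ℝ, ℂ)) :
    HasDerivAt (lineElement θ s f g)
      (lineElement θ s f ((2 * Complex.I) • ((s : ℂ) • g - quadratureOp θ g)) t) t := by
  set h := (2 * Complex.I) • ((s : ℂ) • g - quadratureOp θ g) with hh
  -- Displaced parity only reflects the modulus of a function, so the sup norm of `h` bounds it for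
  -- all `t` simultaneously.
  refine (hasDerivAt_integral_of_dominated_loc_of_deriv_le
    (bound := fun x => SchwartzMap.seminorm ℂ 0 0 h * ‖f x‖) univ_mem
    (Eventually.of_forall fun t => (integrable_braket _ _).aestronglyMeasurable)
    (integrable_braket _ _) (integrable_braket _ _).aestronglyMeasurable
    (Eventually.of_forall fun x t _ => ?_) (f.integrable.norm.const_mul _)
    (Eventually.of_forall fun x t _ =>
      (hasDerivAt_displacedParity_linePoint θ s t x g).const_mul (star (f x)))).2
  rw [norm_mul, norm_star, mul_comm, norm_displacedParity_apply]
  exact mul_le_mul_of_nonneg_right (SchwartzMap.norm_le_seminorm ℂ h _) (norm_nonneg _)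

theorem continuous_lineElement (θ s : ℝ) (f g : 𝓢(ℝ, ℂ)) : Continuous (lineElement θ s f g) :=
  continuous_iff_continuousAt.2 fun t => (hasDerivAt_lineElement θ s t f g).continuousAt

theorem exists_norm_lineElement_le (θ s : ℝ) (f : 𝓢(ℝ, ℂ)) :
    ∃ M : 𝓢(ℝ, ℂ) → ℝ, Continuous M ∧ M 0 = 0 ∧ ∀ (t : ℝ) (g : 𝓢(ℝ, ℂ)),
      ‖lineElement θ s f g t‖ ≤ M g * (1 + t ^ 2)⁻¹ := by
  obtain ⟨M, hM, hM0, hMle⟩ := exists_decay_braket_displacedParity f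
  refine ⟨M, hM, hM0, fun t g => ?_⟩
  rw [← div_eq_mul_inv, le_div_iff₀ (by positivity), mul_comm]
  refine le_trans ?_ (hMle (linePoint θ s t).re (linePoint θ s t).im g)
  refine mul_le_mul_of_nonneg_right ?_ (norm_nonneg _)
  have h : (linePoint θ s t).re ^ 2 + (linePoint θ s t).im ^ 2 = s ^ 2 + t ^ 2 := by
    simp only [linePoint]
    linear_combination (s ^ 2 + t ^ 2) * Real.sin_sq_add_cos_sq θ
  nlinarith [sq_nonneg s]

theorem integrable_lineElement (θ s : ℝ) (f g : 𝓢(ℝ, ℂ)) : Integrable (lineElement θ s f g) := by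
  obtain ⟨M, -, -, hMle⟩ := exists_norm_lineElement_le θ s f
  exact (integrable_inv_one_add_sq.const_mul (M g)).mono'
    (continuous_lineElement θ s f g).aestronglyMeasurable (Eventually.of_forall fun t => hMle t g)

theorem integrableOn_phaseLine (θ s : ℝ) (f g : 𝓢(ℝ, ℂ)) :
    IntegrableOn (fun z => braket f (wigner z g)) (phaseLine θ s) μH[1] := by
  rw [IntegrableOn, restrict_phaseLine, (measurableEmbedding_linePoint θ s).integrable_map_iff]
  refine ((integrable_lineElement θ s f g).const_mul (Real.pi : ℂ)⁻¹).congr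
    (Eventually.of_forall fun t => ?_)
  exact (braket_wigner_linePoint θ s t f g).symm

theorem lineElement_add (θ s : ℝ) (f g h : 𝓢(ℝ, ℂ)) (t : ℝ) :
    lineElement θ s f (g + h) t = lineElement θ s f g t + lineElement θ s f h t := by
  rw [lineElement, map_add, braket_add_right, lineElement, lineElement]

theorem lineElement_smul (θ s : ℝ) (c : ℂ) (f g : 𝓢(ℝ, ℂ)) (t : ℝ) :
    lineElement θ s f (c • g) t = c * lineElement θ s f g t := by
  rw [lineElement, map_smul, braket_smul_right, lineElement]

/-- The functional `⟨f|K` for the region operator `K` of a line. -/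
def lineOpCLM (θ s : ℝ) (f : 𝓢(ℝ, ℂ)) : 𝓢(ℝ, ℂ) →L[ℂ] ℂ where
  toFun := lineOp θ s f
  map_add' g h := by
    simp only [lineOp_eq, lineElement_add]
    rw [integral_add (integrable_lineElement _ _ _ _) (integrable_lineElement _ _ _ _), mul_add]
  map_smul' c g := by
    simp only [lineOp_eq, lineElement_smul]
    rw [integral_const_mul, RingHom.id_apply, smul_eq_mul]
    ring
  cont := by
    obtain ⟨M, hM, hM0, hMle⟩ := exists_norm_lineElement_le θ s f
    let l : 𝓢(ℝ, ℂ) →+ ℂ := AddMonoidHom.mk' (lineOp θ s f) fun g h => by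
      simp only [lineOp_eq, lineElement_add]
      rw [integral_add (integrable_lineElement _ _ _ _) (integrable_lineElement _ _ _ _), mul_add]
    refine continuous_of_continuousAt_zero l ?_
    rw [ContinuousAt, map_zero]
    refine squeeze_zero_norm (a := fun g => Real.pi⁻¹ * (M g * ∫ t : ℝ, (1 + t ^ 2)⁻¹))
      (fun g => ?_) ?_
    · refine (congrArg norm (lineOp_eq θ s f g)).trans_le ?_
      rw [norm_mul, norm_inv, Complex.norm_real, Real.norm_of_nonneg Real.pi_pos.le,
        ← integral_const_mul]
      refine mul_le_mul_of_nonneg_left ?_ (by positivity)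
      exact norm_integral_le_of_norm_le (integrable_inv_one_add_sq.const_mul (M g))
        (Eventually.of_forall fun t => hMle t g)
    · have h : Continuous fun g => Real.pi⁻¹ * (M g * ∫ t : ℝ, (1 + t ^ 2)⁻¹) := by fun_prop
      have h0 := h.tendsto 0
      simpa [hM0] using h0

theorem lineOpCLM_apply (θ s : ℝ) (f g : 𝓢(ℝ, ℂ)) : lineOpCLM θ s f g = lineOp θ s f g := rfl

/-- The matrix element with `2i(s - Q_θ)g` is the derivative along the line of an integrable
function, so its integral vanishes. -/
theorem lineOp_quadratureOp (θ s : ℝ) (f g : 𝓢(ℝ, ℂ)) :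
    lineOp θ s f (quadratureOp θ g) = s * lineOp θ s f g := by
  have h := integral_eq_zero_of_hasDerivAt_of_integrable
    (fun t => hasDerivAt_lineElement θ s t f g) (integrable_lineElement _ _ _ _)
    (integrable_lineElement _ _ _ _)
  have h1 := lineOp_eq θ s f ((2 * Complex.I) • ((s : ℂ) • g - quadratureOp θ g))
  rw [h, mul_zero, ← lineOpCLM_apply, map_smul, map_sub, map_smul, smul_eq_mul, smul_eq_mul] at h1
  have h2 := (mul_eq_zero.1 h1).resolve_left (by simp)
  exact (sub_eq_zero.1 h2).symm

theorem star_lineOp (θ s : ℝ) (f g : 𝓢(ℝ, ℂ)) : star (lineOp θ s f g) = lineOp θ s g f := by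
  rw [lineOp_eq, lineOp_eq, star_mul', Complex.star_def, ← integral_conj, map_inv₀,
    Complex.conj_ofReal]
  congr 1
  refine integral_congr_ae (Eventually.of_forall fun t => ?_)
  simp only [lineElement]
  rw [braket_displacedParity, ← Complex.star_def, star_braket]

/-- The vacuum is even, so parity turns `D(-z)|0⟩` into `D(z)|0⟩`, and displacing once more doubles
the point. -/
theorem displacedParity_numberState_zero (z : ℂ) :
    displacedParity z.re z.im (numberState 0) = coherentState (2 * z) := by
  ext x
  rw [displacedParity_apply, coherentState, displacement_apply, numberState_zero_apply,
    numberState_zero_apply]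
  simp only [Complex.mul_re, Complex.mul_im, Complex.re_ofNat, Complex.im_ofNat]
  push_cast
  congr 2
  · ring
  · ring_nf

/-- Here `⟨0|2z⟩ = e^{-|z|²}` with `|z|² = s² + t²` on the line; the integral over `t` contributes
`√π`. -/
theorem lineOp_numberState_zero (θ s : ℝ) :
    lineOp θ s (numberState 0) (numberState 0) = numberState 0 s * numberState 0 s := by
  have h : ∀ t, lineElement θ s (numberState 0) (numberState 0) t =
      Complex.exp (-(s : ℂ) ^ 2) * ((Real.exp (-1 * t ^ 2) : ℝ) : ℂ) := by
    intro t
    rw [lineElement, displacedParity_numberState_zero, ← coherentState_zero, braket_coherentState]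
    have h1 : linePoint θ s t * star (linePoint θ s t) = ((s ^ 2 + t ^ 2 : ℝ) : ℂ) := by
      rw [Complex.star_def, Complex.mul_conj, Complex.normSq_apply]
      simp only [linePoint]
      congr 1
      linear_combination (s ^ 2 + t ^ 2) * Real.sin_sq_add_cos_sq θ
    rw [Complex.ofReal_exp, ← Complex.exp_add]
    congr 1
    push_cast at h1 ⊢
    simp only [star_zero, star_mul', star_ofNat]
    linear_combination -h1
  have hpi : ((√Real.pi : ℝ) : ℂ) * ((√Real.pi : ℝ) : ℂ) = Real.pi := by
    rw [← Complex.ofReal_mul, Real.mul_self_sqrt Real.pi_pos.le]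
  have h0 : ((√Real.pi : ℝ) : ℂ) ≠ 0 := by
    rw [Complex.ofReal_ne_zero]
    positivity
  rw [lineOp_eq, integral_congr_ae (Eventually.of_forall h), integral_const_mul,
    integral_complex_ofReal, integral_gaussian, numberState_zero_apply, mul_mul_mul_comm,
    pi_rpow_mul_self, ← Complex.exp_add, ← hpi, div_one]
  field_simp
  congr 1
  ring

/-- Uniqueness of eigenfunctionals gives the dependence on `g` up to the factor `⟨f|K|0⟩`. That
factor is the conjugate of `⟨0|K|f⟩`, to which uniqueness applies again, leaving only the vacuum
element. -/
theorem lineOp_apply (θ s : ℝ) (f g : 𝓢(ℝ, ℂ)) :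
    lineOp θ s f g = star (numberRotation (-θ) f s) * numberRotation (-θ) g s := by
  have h1 : ∀ f g, lineOp θ s f g * numberState 0 s =
      numberRotation (-θ) g s * lineOp θ s f (numberState 0) := fun f g =>
    apply_eq_of_quadratureOp_eigen (lineOpCLM θ s f) (lineOp_quadratureOp θ s f) g
  have h0 := numberState_zero_apply_ne_zero s
  have hreal : star (numberState 0 s) = numberState 0 s := by
    have : numberState 0 s = ((Real.pi ^ (-(1 / 4) : ℝ) * Real.exp (-(s ^ 2 / 2)) : ℝ) : ℂ) := by
      rw [numberState_zero_apply]
      push_cast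
      rfl
    rw [this, Complex.star_def, Complex.conj_ofReal]
  have h2 := h1 (numberState 0) f
  rw [lineOp_numberState_zero, ← mul_assoc] at h2
  have h3 := congrArg star (mul_right_cancel₀ h0 h2)
  rw [star_lineOp, star_mul', hreal] at h3
  have h4 := h1 f g
  rw [h3] at h4
  refine mul_right_cancel₀ h0 (h4.trans ?_)
  ring

/-! ### Taylor series and normal ordering. -/

theorem hasSum_of_eq {ι : Type*} {f g : ι → ℂ} {a b : ℂ} (h : HasSum f a) (hfg : ∀ x, g x = f x)
    (hab : b = a) : HasSum g b := by
  rw [hab, funext hfg]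
  exact h

theorem iteratedDeriv_iteratedDeriv (f : ℂ → ℂ) (m n : ℕ) :
    iteratedDeriv m (iteratedDeriv n f) = iteratedDeriv (m + n) f := by
  simp only [iteratedDeriv_eq_iterate, ← Function.iterate_add_apply]

theorem contDiff_iteratedDeriv {f : ℂ → ℂ} (hf : Differentiable ℂ f) (n : ℕ) {m : WithTop ℕ∞} :
    ContDiff ℂ m (iteratedDeriv n f) := by
  rw [iteratedDeriv_eq_iterate]
  refine Differentiable.contDiff ?_
  induction n with
  | zero => exact hf
  | succ n ih =>
    rw [Function.iterate_succ_apply']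
    exact ih.contDiff.differentiable_deriv_two

theorem taylorCoeff_linear {F : ℂ → ℂ} (hF : Differentiable ℂ F) (U V : ℂ) (m n : ℕ) :
    taylorCoeff (fun x y => F (U * x + V * y)) m n =
      iteratedDeriv (m + n) F 0 * U ^ m * V ^ n / (m.factorial * n.factorial) := by
  have h1 : ∀ x : ℂ, iteratedDeriv n (fun y => F (U * x + V * y)) 0 =
      V ^ n * iteratedDeriv n F (U * x) := by
    intro x
    have h2 : (fun y : ℂ => F (U * x + V * y)) = fun y => (fun w => F (w + U * x)) (V * y) := by
      funext y
      simp only [add_comm]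
    have h3 : ContDiff ℂ n fun w => F (w + U * x) := by
      have := hF.contDiff (n := n)
      fun_prop
    rw [h2, iteratedDeriv_comp_const_mul h3, iteratedDeriv_comp_add_const]
    simp
  rw [taylorCoeff]
  simp only [h1]
  rw [iteratedDeriv_const_mul_field, iteratedDeriv_comp_const_mul (contDiff_iteratedDeriv hF n),
    iteratedDeriv_iteratedDeriv]
  simp only [mul_zero]
  ring

theorem sum_antidiagonal_pow_div (e A B : ℂ) (k : ℕ) :
    ∑ x ∈ Finset.HasAntidiagonal.antidiagonal k,
      e * A ^ x.1 * B ^ x.2 / (x.1.factorial * x.2.factorial) =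
      e * (A + B) ^ k / k.factorial := by
  rw [(Commute.all A B).add_pow', Finset.mul_sum, Finset.sum_div]
  refine Finset.sum_congr rfl fun x hx => ?_
  rw [Finset.HasAntidiagonal.mem_antidiagonal] at hx
  subst hx
  have h := Nat.add_choose_mul_factorial_mul_factorial x.1 x.2
  have h1 : (x.1.factorial : ℂ) ≠ 0 := by exact_mod_cast x.1.factorial_ne_zero
  have h2 : (x.2.factorial : ℂ) ≠ 0 := by exact_mod_cast x.2.factorial_ne_zero
  have h3 : ((x.1 + x.2).factorial : ℂ) ≠ 0 := by exact_mod_cast (x.1 + x.2).factorial_ne_zero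
  have h4 : ((x.1 + x.2).choose x.1 : ℂ) * x.1.factorial * x.2.factorial =
      (x.1 + x.2).factorial := by
    rw [Nat.choose_symm_add]
    exact_mod_cast h
  rw [nsmul_eq_mul, div_eq_div_iff (mul_ne_zero h1 h2) h3, ← h4]
  ring

/-- Grouping by total degree and the binomial theorem reduce the double series to the Taylor series
at `A + B`. -/
theorem hasSum_taylor_linear {F : ℂ → ℂ} (hF : Differentiable ℂ F) (A B : ℂ) :
    HasSum (fun x : ℕ × ℕ => iteratedDeriv (x.1 + x.2) F 0 * A ^ x.1 * B ^ x.2 /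
      (x.1.factorial * x.2.factorial)) (F (A + B)) := by
  set e : ℕ → ℂ := fun k => iteratedDeriv k F 0 with he
  have htaylor : ∀ z, HasSum (fun k => e k * z ^ k / k.factorial) (F z) := by
    intro z
    have h := Complex.hasSum_taylorSeries_of_entire hF 0 z
    refine hasSum_of_eq h (fun k => ?_) rfl
    simp only [sub_zero, smul_eq_mul, he]
    ring
  let φ := Finset.HasAntidiagonal.sigmaAntidiagonalEquivProd (A := ℕ)
  rw [← φ.hasSum_iff]
  have hsum : Summable ((fun x : ℕ × ℕ => e (x.1 + x.2) * A ^ x.1 * B ^ x.2 /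
      (x.1.factorial * x.2.factorial)) ∘ φ) := by
    refine Summable.of_norm ?_
    rw [summable_sigma_of_nonneg fun x => norm_nonneg _]
    refine ⟨fun k => Summable.of_finite, ?_⟩
    -- The norms regroup in the same way, so absolute convergence of the one-variable series at `‖A‖
    -- + ‖B‖` suffices.
    have h := (htaylor ((‖A‖ + ‖B‖ : ℝ) : ℂ)).summable.norm
    refine h.congr fun k => ?_
    have h1 : ((∑ x ∈ Finset.HasAntidiagonal.antidiagonal k, ‖e k‖ * ‖A‖ ^ x.1 * ‖B‖ ^ x.2 /
        (x.1.factorial * x.2.factorial) : ℝ) : ℂ) =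
        ((‖e k‖ * (‖A‖ + ‖B‖) ^ k / k.factorial : ℝ) : ℂ) := by
      push_cast
      exact sum_antidiagonal_pow_div _ _ _ k
    have h2 : ‖e k * ((‖A‖ + ‖B‖ : ℝ) : ℂ) ^ k / k.factorial‖ =
        ‖e k‖ * (‖A‖ + ‖B‖) ^ k / k.factorial := by
      rw [norm_div, norm_mul, norm_pow, Complex.norm_real, Complex.norm_natCast,
        Real.norm_of_nonneg (by positivity)]
    rw [h2, ← Complex.ofReal_inj.1 h1, tsum_fintype,
      ← Finset.sum_coe_sort (Finset.HasAntidiagonal.antidiagonal k)]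
    refine Finset.sum_congr rfl fun x _ => ?_
    have hx := Finset.HasAntidiagonal.mem_antidiagonal.1 x.2
    simp [φ, hx]
  have hinner : ∀ k, HasSum (fun x : Finset.HasAntidiagonal.antidiagonal k =>
      ((fun x : ℕ × ℕ => e (x.1 + x.2) * A ^ x.1 * B ^ x.2 /
      (x.1.factorial * x.2.factorial)) ∘ φ) ⟨k, x⟩) (e k * (A + B) ^ k / k.factorial) := by
    intro k
    rw [← sum_antidiagonal_pow_div, ← Finset.sum_coe_sort (Finset.HasAntidiagonal.antidiagonal k)]
    refine hasSum_of_eq (hasSum_fintype _) (fun x => ?_) rfl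
    have hx := Finset.HasAntidiagonal.mem_antidiagonal.1 x.2
    simp [φ, hx]
  rw [← (hsum.hasSum.sigma hinner).unique (htaylor (A + B))]
  exact hsum.hasSum

/-- The entire function `π^{-1/2} exp (-(s - w)²)`. -/
def gaussianSymbol (s : ℝ) (w : ℂ) : ℂ :=
  ((√Real.pi : ℝ) : ℂ)⁻¹ * Complex.exp (-((s : ℂ) - w) ^ 2)

theorem differentiable_gaussianSymbol (s : ℝ) : Differentiable ℂ (gaussianSymbol s) := by
  unfold gaussianSymbol
  fun_prop

theorem lineSymbol_eq (θ s : ℝ) : lineSymbol θ s = fun x y => gaussianSymbol s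
    (((√2 : ℝ) : ℂ)⁻¹ * Complex.exp (Complex.I * θ) * x +
      ((√2 : ℝ) : ℂ)⁻¹ * Complex.exp (-(Complex.I * θ)) * y) := by
  funext x y
  rw [lineSymbol, quadratureSymbol, gaussianSymbol]
  congr 4
  ring

theorem normalOrderTerm_lineSymbol (θ s : ℝ) (f g : 𝓢(ℝ, ℂ)) (x : ℕ × ℕ) :
    normalOrderTerm (lineSymbol θ s) f g x =
      iteratedDeriv (x.1 + x.2) (gaussianSymbol s) 0 *
        (((√2 : ℝ) : ℂ)⁻¹ * Complex.exp (Complex.I * θ)) ^ x.1 *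
        (((√2 : ℝ) : ℂ)⁻¹ * Complex.exp (-(Complex.I * θ))) ^ x.2 /
        (x.1.factorial * x.2.factorial) *
        braket ((annihilation ^ x.1) f) ((annihilation ^ x.2) g) := by
  rw [normalOrderTerm, lineSymbol_eq, taylorCoeff_linear (differentiable_gaussianSymbol s)]

theorem annihilation_pow_coherentState (n : ℕ) (z : ℂ) :
    (annihilation ^ n) (coherentState z) = (((√2 : ℝ) : ℂ)⁻¹ * z) ^ n • coherentState z := by
  induction n with
  | zero => simp
  | succ n ih =>
    rw [pow_succ, mul_apply_eq_comp, annihilation_coherentState, map_smul, ih, smul_smul, pow_succ']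

theorem star_exp_I_mul (θ : ℝ) :
    star (Complex.exp (Complex.I * θ)) = Complex.exp (-(Complex.I * θ)) := by
  rw [Complex.star_def, ← Complex.exp_conj]
  simp

/-- Coherent states are eigenvectors of `a`, so the series is the Taylor series of the symbol at `a†
= star w/√2`, `a = z/√2`, times `⟨w|z⟩`. The closed form is compared with the rotated coherent
states evaluated at `s`. -/
theorem hasSum_normalOrderTerm_coherentState (θ s : ℝ) (w z : ℂ) :
    HasSum (normalOrderTerm (lineSymbol θ s) (coherentState w) (coherentState z))
      (lineOp θ s (coherentState w) (coherentState z)) := by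
  set u := Complex.exp (Complex.I * θ) with hu
  set v := Complex.exp (-(Complex.I * θ)) with hv
  have huv : u * v = 1 := by rw [hu, hv, ← Complex.exp_add, add_neg_cancel, Complex.exp_zero]
  have hstar : star v = u := by rw [hv, ← star_exp_I_mul, star_star]
  have hstar' : star u = v := by rw [hu, star_exp_I_mul]
  have h := (hasSum_taylor_linear (differentiable_gaussianSymbol s)
    (u * star w / 2) (v * z / 2)).mul_right (braket (coherentState w) (coherentState z))
  refine hasSum_of_eq h (fun x => ?_) ?_
  · rw [normalOrderTerm_lineSymbol, annihilation_pow_coherentState, annihilation_pow_coherentState,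
      braket_smul_left, braket_smul_right, star_pow, star_mul', star_sqrt_two_inv]
    have h1 : u * star w / 2 = ((√2 : ℝ) : ℂ)⁻¹ * u * (((√2 : ℝ) : ℂ)⁻¹ * star w) := by
      linear_combination -(u * star w) * sqrt_two_inv_mul_self
    have h2 : v * z / 2 = ((√2 : ℝ) : ℂ)⁻¹ * v * (((√2 : ℝ) : ℂ)⁻¹ * z) := by
      linear_combination -(v * z) * sqrt_two_inv_mul_self
    rw [h1, h2, mul_pow _ (((√2 : ℝ) : ℂ)⁻¹ * star w), mul_pow _ (((√2 : ℝ) : ℂ)⁻¹ * z)]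
    ring
  · rw [lineOp_apply, numberRotation_coherentState, numberRotation_coherentState,
      coherentState_apply, coherentState_apply, braket_coherentState, gaussianSymbol]
    have hv' : Complex.exp (Complex.I * ((-θ : ℝ) : ℂ)) = v := by
      rw [hv]
      push_cast
      ring_nf
    have hexp : ∀ c : ℂ, star (Complex.exp c) = Complex.exp (star c) := fun c =>
      (Complex.exp_conj c).symm
    have hreal : ∀ r : ℝ, star (r : ℂ) = r := Complex.conj_ofReal
    rw [hv', star_mul', hexp, hreal, mul_mul_mul_comm, pi_rpow_mul_self, ← Complex.exp_add,
      mul_assoc (((√Real.pi : ℝ) : ℂ)⁻¹), ← Complex.exp_add]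
    congr 2
    simp only [star_sub, star_mul', star_div₀, star_pow, star_star, hstar, hstar', star_ofNat,
      hreal]
    linear_combination (star w * z / 2 - w * star w / 4 - z * star z / 4) * huv

/-- Repeated differentiation of `G' = 2(s - w)G`. At `k = 0` the truncated index is multiplied by
zero. -/
theorem iteratedDeriv_gaussianSymbol_succ (s : ℝ) (k : ℕ) (w : ℂ) :
    iteratedDeriv (k + 1) (gaussianSymbol s) w =
      2 * (s - w) * iteratedDeriv k (gaussianSymbol s) w -
      2 * k * iteratedDeriv (k - 1) (gaussianSymbol s) w := by
  have hd : ∀ (k : ℕ) (w : ℂ), HasDerivAt (iteratedDeriv k (gaussianSymbol s))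
      (iteratedDeriv (k + 1) (gaussianSymbol s) w) w := by
    intro k w
    rw [iteratedDeriv_succ]
    exact ((contDiff_iteratedDeriv (differentiable_gaussianSymbol s) k
      (m := 1)).differentiable one_ne_zero w).hasDerivAt
  induction k generalizing w with
  | zero =>
    have h1 : HasDerivAt (fun w : ℂ => -((s : ℂ) - w) ^ 2) (2 * (s - w)) w := by
      refine (((hasDerivAt_id w).const_sub (s : ℂ)).pow 2).neg.congr_deriv ?_
      simp
    have h2 : HasDerivAt (gaussianSymbol s) _ w := h1.cexp.const_mul ((√Real.pi : ℝ) : ℂ)⁻¹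
    rw [zero_add, iteratedDeriv_one, h2.deriv, iteratedDeriv_zero, gaussianSymbol]
    simp only [Nat.cast_zero]
    ring
  | succ k ih =>
    have h1 : iteratedDeriv (k + 1) (gaussianSymbol s) = fun w =>
      2 * (s - w) * iteratedDeriv k (gaussianSymbol s) w -
      2 * k * iteratedDeriv (k - 1) (gaussianSymbol s) w := funext ih
    have h2 := (((((hasDerivAt_id w).const_sub (s : ℂ)).const_mul 2).mul (hd k w)).sub
      ((hd (k - 1) w).const_mul (2 * k : ℂ)))
    have h3 : (2 * k : ℂ) * iteratedDeriv (k - 1 + 1) (gaussianSymbol s) w =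
        2 * k * iteratedDeriv k (gaussianSymbol s) w := by
      cases k <;> simp
    rw [h3] at h2
    rw [iteratedDeriv_succ, h1]
    refine h2.deriv.trans ?_
    rw [Nat.add_sub_cancel]
    push_cast
    simp only [id]
    linear_combination 2 * (s - w) * ih w

theorem star_iteratedDeriv_gaussianSymbol (s : ℝ) (k : ℕ) :
    star (iteratedDeriv k (gaussianSymbol s) 0) = iteratedDeriv k (gaussianSymbol s) 0 := by
  induction k using Nat.strong_induction_on with
  | _ k ih =>
    cases k with
    | zero =>
      have : gaussianSymbol s 0 = (((√Real.pi)⁻¹ * Real.exp (-s ^ 2) : ℝ) : ℂ) := by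
        simp [gaussianSymbol]
      rw [iteratedDeriv_zero, this, Complex.star_def, Complex.conj_ofReal]
    | succ k =>
      rw [iteratedDeriv_gaussianSymbol_succ, star_sub, star_mul', star_mul' (2 * (k : ℂ)),
        star_mul' (2 : ℂ), ih k (by omega), ih (k - 1) (by omega)]
      simp

theorem annihilation_pow_creation (j : ℕ) (g : 𝓢(ℝ, ℂ)) : (annihilation ^ j) (creation g) =
    creation ((annihilation ^ j) g) + (j : ℂ) • (annihilation ^ (j - 1)) g := by
  induction j generalizing g with
  | zero => simp
  | succ j ih =>
    rw [pow_succ', mul_apply_eq_comp, ih, map_add, annihilation_creation, map_smul,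
      Nat.add_sub_cancel, mul_apply_eq_comp]
    have h : (j : ℂ) • annihilation ((annihilation ^ (j - 1)) g) =
        (j : ℂ) • (annihilation ^ j) g := by
      cases j with
      | zero => simp
      | succ j => rw [Nat.add_sub_cancel, pow_succ' _ j, mul_apply_eq_comp]
    rw [h, add_assoc, Nat.cast_succ, add_smul, one_smul, add_comm ((j : ℂ) • _)]

theorem annihilation_pow_numberState {m i : ℕ} (h : m < i) :
    (annihilation ^ i) (numberState m) = 0 := by
  induction m generalizing i with
  | zero =>
    obtain ⟨i, rfl⟩ := Nat.exists_eq_succ_of_ne_zero h.ne'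
    rw [pow_succ, mul_apply_eq_comp, annihilation_numberState_zero, map_zero]
  | succ m ih =>
    obtain ⟨i, rfl⟩ := Nat.exists_eq_succ_of_ne_zero (Nat.ne_zero_of_lt h)
    rw [pow_succ, mul_apply_eq_comp, annihilation_numberState_succ, map_smul, ih (by omega),
      smul_zero]

/-- The normally ordered series inherits the eigenvalue equation of `K`. Moving `aʲ` past `a†`
produces three families of terms; after index shifts their coefficients combine by the Hermite-type
recurrence. The annihilation hypotheses leave finitely many nonzero matrix elements, so no
rearrangement is in doubt. -/
theorem hasSum_normalOrderTerm_quadratureOp {θ s : ℝ} {f g : 𝓢(ℝ, ℂ)} {N : ℕ} {c : ℂ}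
    (hf : ∀ i ≥ N, (annihilation ^ i) f = 0) (hg : ∀ i ≥ N, (annihilation ^ i) g = 0)
    (h : HasSum (normalOrderTerm (lineSymbol θ s) f g) c) :
    HasSum (normalOrderTerm (lineSymbol θ s) f (quadratureOp θ g)) (s * c) := by
  have hterm := normalOrderTerm_lineSymbol θ s
  set u := Complex.exp (Complex.I * θ) with hu
  set v := Complex.exp (-(Complex.I * θ)) with hv
  have huv : u * v = 1 := by rw [hu, hv, ← Complex.exp_add, add_neg_cancel, Complex.exp_zero]
  set U := ((√2 : ℝ) : ℂ)⁻¹ * u with hU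
  set V := ((√2 : ℝ) : ℂ)⁻¹ * v with hV
  have hUV : U * V = 1 / 2 := by
    rw [hU, hV]
    linear_combination sqrt_two_inv_mul_self + (((√2 : ℝ) : ℂ)⁻¹ * ((√2 : ℝ) : ℂ)⁻¹) *
      huv
  obtain ⟨e, he⟩ : ∃ e : ℕ → ℂ, e = fun k => iteratedDeriv k (gaussianSymbol s) 0 := ⟨_, rfl⟩
  obtain ⟨M, hM⟩ : ∃ M : ℕ → ℕ → ℂ, M = fun i j =>
    braket ((annihilation ^ i) f) ((annihilation ^ j) g) := ⟨_, rfl⟩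
  obtain ⟨D, hD⟩ : ∃ D : ℕ → ℕ → ℂ, D = fun i j =>
    U ^ i * V ^ j / (i.factorial * j.factorial) := ⟨_, rfl⟩
  have hrec : ∀ k, e (k + 1) = 2 * s * e k - 2 * k * e (k - 1) := by
    intro k
    simp only [he, iteratedDeriv_gaussianSymbol_succ, sub_zero]
  have hD1 : ∀ i j, (i + 1) * D (i + 1) j = U * D i j := by
    intro i j
    have h1 : (i + 1 : ℂ) ≠ 0 := by exact_mod_cast i.succ_ne_zero
    simp only [hD, Nat.factorial_succ]
    push_cast
    field_simp
    ring
  have hD2 : ∀ i j, (j + 1) * D i (j + 1) = V * D i j := by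
    intro i j
    have h1 : (j + 1 : ℂ) ≠ 0 := by exact_mod_cast j.succ_ne_zero
    simp only [hD, Nat.factorial_succ]
    push_cast
    field_simp
    ring
  have hsum : ∀ a : ℕ → ℕ → ℂ, Summable fun x : ℕ × ℕ => a x.1 x.2 * M x.1 x.2 := by
    intro a
    refine summable_of_ne_finset_zero (s := Finset.range N ×ˢ Finset.range N) fun x hx => ?_
    rw [Finset.mem_product, Finset.mem_range, Finset.mem_range, not_and_or, not_lt, not_lt] at hx
    rw [hM]
    rcases hx with hx | hx
    · simp only [hf _ hx, braket_zero_left, mul_zero]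
    · simp only [hg _ hx, braket_zero_right, mul_zero]
  -- These are the shifted families, written as coefficients of `M i j`. The factors `i` and `j`
  -- kill the terms where the subtraction truncates or the shift has no preimage.
  obtain ⟨T₁, h₁⟩ := hsum fun i j => i * e (i + j - 1) * D i j
  obtain ⟨T₂, h₂⟩ := hsum fun i j => j * e (i + j - 1) * D i j
  obtain ⟨T₃, h₃⟩ := hsum fun i j => e (i + j + 1) * (U * V) * D i j
  have hs₁ : HasSum (fun x : ℕ × ℕ => e (x.1 + x.2) * U * D x.1 x.2 * M (x.1 + 1) x.2) T₁ := by
    have hinj : Function.Injective fun x : ℕ × ℕ => (x.1 + 1, x.2) := by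
      rintro ⟨a, b⟩ ⟨c, d⟩ h
      simpa using h
    rw [← hinj.hasSum_iff] at h₁
    · refine hasSum_of_eq h₁ (fun x => ?_) rfl
      have := hD1 x.1 x.2
      simp only [Function.comp_apply, show x.1 + 1 + x.2 - 1 = x.1 + x.2 by omega]
      push_cast
      linear_combination -e (x.1 + x.2) * M (x.1 + 1) x.2 * this
    · rintro ⟨i, j⟩ hx
      cases i with
      | zero => simp
      | succ i => exact absurd ⟨(i, j), rfl⟩ hx
  have hs₂ : HasSum (fun x : ℕ × ℕ => e (x.1 + x.2) * V * D x.1 x.2 * M x.1 (x.2 + 1)) T₂ := by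
    have hinj : Function.Injective fun x : ℕ × ℕ => (x.1, x.2 + 1) := by
      rintro ⟨a, b⟩ ⟨c, d⟩ h
      simpa using h
    rw [← hinj.hasSum_iff] at h₂
    · refine hasSum_of_eq h₂ (fun x => ?_) rfl
      have := hD2 x.1 x.2
      simp only [Function.comp_apply, show x.1 + (x.2 + 1) - 1 = x.1 + x.2 by omega]
      push_cast
      linear_combination -e (x.1 + x.2) * M x.1 (x.2 + 1) * this
    · rintro ⟨i, j⟩ hx
      cases j with
      | zero => simp
      | succ j => exact absurd ⟨(i, j), rfl⟩ hx
  have hs₃ : HasSum (fun x : ℕ × ℕ => e (x.1 + x.2) * U * (x.2 * D x.1 x.2) * M x.1 (x.2 - 1))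
      T₃ := by
    have hinj : Function.Injective fun x : ℕ × ℕ => (x.1, x.2 + 1) := by
      rintro ⟨a, b⟩ ⟨c, d⟩ h
      simpa using h
    rw [← hinj.hasSum_iff]
    · refine hasSum_of_eq h₃ (fun x => ?_) rfl
      have := hD2 x.1 x.2
      simp only [Function.comp_apply, Nat.add_sub_cancel, ← add_assoc]
      push_cast
      linear_combination e (x.1 + x.2 + 1) * U * M x.1 x.2 * this
    · rintro ⟨i, j⟩ hx
      cases j with
      | zero => simp
      | succ j => exact absurd ⟨(i, j), rfl⟩ hx
  -- With `k = i + j` and `UV = 1/2`, the three coefficients add up to `k e(k-1) + e(k+1)/2 = s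
  -- e(k)`.
  have hc : T₁ + T₂ + T₃ = s * c := by
    refine ((h₁.add h₂).add h₃).unique ?_
    refine hasSum_of_eq (h.mul_left (s : ℂ)) (fun x => ?_) rfl
    rw [hterm, hUV, hrec]
    simp only [he, hM, hD]
    push_cast
    ring
  rw [← hc]
  refine hasSum_of_eq ((hs₁.add hs₂).add hs₃) (fun x => ?_) rfl
  rw [hterm, quadratureOp_eq, map_smul, map_add, map_smul, map_smul, annihilation_pow_creation,
    braket_smul_right, braket_add_right, braket_smul_right, braket_smul_right, braket_add_right,
    braket_smul_right, braket_creation, ← mul_apply_eq_comp, ← pow_succ', ← mul_apply_eq_comp,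
    ← pow_succ]
  simp only [he, hM, hD, hU, hV]
  ring

/-- The derivatives of the symbol at `0` are real and conjugation exchanges the phases of `a†` and
`a`, so the coefficient matrix is Hermitian. -/
theorem hasSum_normalOrderTerm_swap {θ s : ℝ} {f g : 𝓢(ℝ, ℂ)} {c : ℂ}
    (h : HasSum (normalOrderTerm (lineSymbol θ s) f g) c) :
    HasSum (normalOrderTerm (lineSymbol θ s) g f) (star c) := by
  rw [← (Equiv.prodComm ℕ ℕ).hasSum_iff]
  refine hasSum_of_eq h.star (fun x => ?_) rfl
  have hstar : star (Complex.exp (-(Complex.I * θ))) = Complex.exp (Complex.I * θ) := by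
    rw [← star_exp_I_mul, star_star]
  simp only [Function.comp_apply, normalOrderTerm_lineSymbol, Equiv.prodComm_apply, Prod.fst_swap,
    Prod.snd_swap, star_mul', star_div₀, star_pow, star_natCast, star_sqrt_two_inv, hstar,
    star_exp_I_mul, star_braket, star_iteratedDeriv_gaussianSymbol]
  rw [add_comm x.2]
  ring

/-- Induction on the right index uses the common eigenvalue equation. Starting from the vacuum pair
it reaches `(0, m)`, the swap gives `(m, 0)`, and a second induction gives `(m, n)`. -/
theorem hasSum_normalOrderTerm_numberState (θ s : ℝ) (m n : ℕ) :
    HasSum (normalOrderTerm (lineSymbol θ s) (numberState m) (numberState n))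
      (lineOp θ s (numberState m) (numberState n)) := by
  have hstep : ∀ m : ℕ, HasSum (normalOrderTerm (lineSymbol θ s) (numberState m) (numberState 0))
      (lineOp θ s (numberState m) (numberState 0)) → ∀ n : ℕ,
      HasSum (normalOrderTerm (lineSymbol θ s) (numberState m) (numberState n))
        (lineOp θ s (numberState m) (numberState n)) := by
    intro m h0 n
    induction n using Nat.strong_induction_on with
    | _ n ih =>
      cases n with
      | zero => exact h0
      | succ n =>
        have hN : ∀ (N k : ℕ), k < N → ∀ i ≥ N, (annihilation ^ i) (numberState k) = 0 :=
          fun N k hk i hi => annihilation_pow_numberState (hk.trans_le hi)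
        have h1 := hasSum_normalOrderTerm_quadratureOp (hN (m + n + 1) m (by omega))
          (hN (m + n + 1) n (by omega)) (ih n (by omega))
        have h2 := ih (n - 1) (by omega)
        rw [← lineOp_quadratureOp] at h1
        simp only [← lineOpCLM_apply] at h1 h2 ⊢
        set u := Complex.exp (Complex.I * θ) with hu
        set v := Complex.exp (-(Complex.I * θ)) with hv
        have huv : v * u = 1 := by
          rw [hu, hv, ← Complex.exp_add, neg_add_cancel, Complex.exp_zero]
        set r := ((√(n + 1 : ℝ) : ℝ) : ℂ) with hr
        have hr0 : r ≠ 0 := by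
          rw [hr, Complex.ofReal_ne_zero]
          positivity
        -- The action of `Q_θ` on `|n⟩`, solved for `|n + 1⟩`.
        have hg : numberState (n + 1) = (r⁻¹ * v * ((√2 : ℝ) : ℂ)) •
            quadratureOp θ (numberState n) +
            (-(r⁻¹ * v * v * ((√(n : ℝ) : ℝ) : ℂ))) • numberState (n - 1) := by
          have h3 : r⁻¹ * v * ((√2 : ℝ) : ℂ) * ((√2 : ℝ) : ℂ)⁻¹ = r⁻¹ * v := by
            rw [← sqrt_two_inv_mul_two]
            field_simp
          have h4 : r⁻¹ * v * (u * r) = 1 := by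
            linear_combination (r⁻¹ * r) * huv + inv_mul_cancel₀ hr0
          have h5 : r⁻¹ * v * (v * ((√(n : ℝ) : ℝ) : ℂ)) +
              -(r⁻¹ * v * v * ((√(n : ℝ) : ℝ) : ℂ)) = 0 := by ring
          rw [quadratureOp_numberState, smul_smul, h3, smul_add, smul_smul, smul_smul, ← hr, ← hu,
            ← hv, h4, one_smul, add_assoc, ← add_smul, h5, zero_smul, add_zero]
        have h3 := (h1.mul_left (r⁻¹ * v * ((√2 : ℝ) : ℂ))).add
          (h2.mul_left (-(r⁻¹ * v * v * ((√(n : ℝ) : ℝ) : ℂ))))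
        refine hasSum_of_eq h3 (fun x => ?_) ?_
        · rw [hg]
          simp only [normalOrderTerm, map_add, map_smul, braket_add_right, braket_smul_right]
          ring
        · rw [hg, map_add, map_smul, map_smul, smul_eq_mul, smul_eq_mul]
  have h00 : HasSum (normalOrderTerm (lineSymbol θ s) (numberState 0) (numberState 0))
      (lineOp θ s (numberState 0) (numberState 0)) := by
    simpa only [coherentState_zero] using hasSum_normalOrderTerm_coherentState θ s 0 0
  refine hstep m ?_ n
  have h := hasSum_normalOrderTerm_swap (hstep 0 h00 m)
  rwa [star_lineOp] at h

theorem hasSum_normalOrderTerm_of_mem_span (θ s : ℝ) {f g : 𝓢(ℝ, ℂ)}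
    (hf : f ∈ Submodule.span ℂ (Set.range numberState))
    (hg : g ∈ Submodule.span ℂ (Set.range numberState)) :
    HasSum (normalOrderTerm (lineSymbol θ s) f g) (lineOp θ s f g) := by
  have hright : ∀ f g : 𝓢(ℝ, ℂ), (∀ n, HasSum (normalOrderTerm (lineSymbol θ s) f (numberState n))
      (lineOp θ s f (numberState n))) → g ∈ Submodule.span ℂ (Set.range numberState) →
      HasSum (normalOrderTerm (lineSymbol θ s) f g) (lineOp θ s f g) := by
    intro f g h hg
    simp only [← lineOpCLM_apply] at h ⊢
    induction hg using Submodule.span_induction with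
    | mem g hg =>
      obtain ⟨n, rfl⟩ := hg
      exact h n
    | zero =>
      rw [map_zero]
      refine hasSum_of_eq (hasSum_zero) (fun x => ?_) rfl
      simp [normalOrderTerm, braket_zero_right]
    | add g k _ _ hg hk =>
      rw [map_add]
      refine hasSum_of_eq (hg.add hk) (fun x => ?_) rfl
      simp only [normalOrderTerm, map_add, braket_add_right, mul_add]
    | smul a g _ hg =>
      rw [map_smul]
      refine hasSum_of_eq (hg.mul_left a) (fun x => ?_) rfl
      simp only [normalOrderTerm, map_smul, braket_smul_right]
      ring
  have hn : ∀ n, HasSum (normalOrderTerm (lineSymbol θ s) (numberState n) f)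
      (lineOp θ s (numberState n) f) := fun n =>
    hright _ f (fun m => hasSum_normalOrderTerm_numberState θ s n m) hf
  refine hright f g (fun n => ?_) hg
  have h := hasSum_normalOrderTerm_swap (hn n)
  rwa [star_lineOp] at h

/-! ### Rotated spectral projections on `L²(ℝ)`. -/

theorem inner_toLp (f g : 𝓢(ℝ, ℂ)) : inner ℂ (f.toLp 2) (g.toLp 2) = braket f g := by
  refine (SchwartzMap.inner_toL2_toL2_eq f g volume).trans ?_
  refine integral_congr_ae (Eventually.of_forall fun x => ?_)
  simp [mul_comm]

theorem exp_I_mul_star (θ : ℝ) (n : ℕ) :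
    star (Complex.exp (Complex.I * θ * n)) * Complex.exp (Complex.I * θ * n) = 1 := by
  rw [Complex.star_def, ← Complex.exp_conj, ← Complex.exp_add]
  simp

/-- The vectors `e^{i θ n} |n⟩` of `L²(ℝ)`. -/
def rotatedNumberVector (θ : ℝ) (n : ℕ) : Lp ℂ 2 (volume : Measure ℝ) :=
  Complex.exp (Complex.I * θ * n) • (numberState n).toLp 2 volume

theorem orthonormal_rotatedNumberVector (θ : ℝ) : Orthonormal ℂ (rotatedNumberVector θ) := by
  classical
  rw [orthonormal_iff_ite]
  intro m n
  rw [rotatedNumberVector, rotatedNumberVector, inner_smul_left, inner_smul_right, inner_toLp,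
    braket_numberState]
  by_cases h : m = n
  · subst h
    simpa using exp_I_mul_star θ m
  · simp [h]

theorem hasSum_smul_rotatedNumberVector (θ : ℝ) (f : 𝓢(ℝ, ℂ)) :
    HasSum (fun n => braket (numberState n) f • rotatedNumberVector θ n)
      ((numberRotation θ f).toLp 2) := by
  have h := (hasSum_numberRotation θ f).mapL (SchwartzMap.toLpCLM ℂ ℂ 2 volume)
  have h1 : ∀ n, SchwartzMap.toLpCLM ℂ ℂ 2 volume (numberRotationTerm θ f n) =
      braket (numberState n) f • rotatedNumberVector θ n := by
    intro n
    rw [numberRotationTerm, map_smul, rotatedNumberVector, smul_smul, mul_comm]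
    rfl
  simp only [h1] at h
  exact h

/-- Schwartz functions are dense in `L²`, and each is `e^{iθN}` of the Schwartz function `e^{-iθN}
f`, hence a limit of combinations of the rotated vectors. -/
theorem top_le_span_rotatedNumberVector (θ : ℝ) :
    ⊤ ≤ (Submodule.span ℂ (Set.range (rotatedNumberVector θ))).topologicalClosure := by
  have hdense := SchwartzMap.denseRange_toLpCLM (E := ℝ) (F := ℂ) (p := 2) (μ := volume)
    (by norm_num)
  intro x _
  rw [← SetLike.mem_coe, Submodule.topologicalClosure_coe]
  refine closure_minimal ?_ isClosed_closure (hdense x)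
  rintro _ ⟨f, rfl⟩
  have h := hasSum_smul_rotatedNumberVector θ (numberRotation (-θ) f)
  rw [numberRotation_numberRotation, add_neg_cancel, numberRotation_zero] at h
  exact mem_closure_of_tendsto h (Eventually.of_forall fun s =>
    Submodule.sum_mem _ fun n _ => Submodule.smul_mem _ _ (Submodule.subset_span ⟨n, rfl⟩))

/-- The Hilbert basis of the vectors `e^{i θ n} |n⟩`. -/
def rotatedNumberBasis (θ : ℝ) : HilbertBasis ℕ ℂ (Lp ℂ 2 (volume : Measure ℝ)) :=
  HilbertBasis.mk (orthonormal_rotatedNumberVector θ) (top_le_span_rotatedNumberVector θ)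

theorem rotatedNumberBasis_apply (θ : ℝ) (n : ℕ) :
    rotatedNumberBasis θ n = rotatedNumberVector θ n := by
  rw [rotatedNumberBasis, HilbertBasis.coe_mk]

/-- The unitary operator `e^{i θ N}` of `L²(ℝ)`. -/
def numberUnitary (θ : ℝ) :
    Lp ℂ 2 (volume : Measure ℝ) ≃ₗᵢ[ℂ] Lp ℂ 2 (volume : Measure ℝ) :=
  (rotatedNumberBasis 0).repr.trans (rotatedNumberBasis θ).repr.symm

theorem numberUnitary_rotatedNumberVector (θ : ℝ) (n : ℕ) :
    numberUnitary θ (rotatedNumberVector 0 n) = rotatedNumberVector θ n := by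
  classical
  rw [← rotatedNumberBasis_apply, ← rotatedNumberBasis_apply, numberUnitary,
    LinearIsometryEquiv.trans_apply, HilbertBasis.repr_self, HilbertBasis.repr_symm_single]

theorem numberUnitary_toLp (θ : ℝ) (f : 𝓢(ℝ, ℂ)) :
    numberUnitary θ (f.toLp 2) = (numberRotation θ f).toLp 2 := by
  have h := (hasSum_smul_rotatedNumberVector 0 f).mapL
    ((numberUnitary θ).toContinuousLinearEquiv : Lp ℂ 2 (volume : Measure ℝ) →L[ℂ]
      Lp ℂ 2 (volume : Measure ℝ))
  rw [numberRotation_zero] at h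
  refine h.unique ?_
  convert hasSum_smul_rotatedNumberVector θ f using 2 with n
  rw [map_smul]
  exact congrArg _ (numberUnitary_rotatedNumberVector θ n)

theorem numberUnitary_symm_toLp (θ : ℝ) (f : 𝓢(ℝ, ℂ)) :
    (numberUnitary θ).symm (f.toLp 2) = (numberRotation (-θ) f).toLp 2 := by
  rw [LinearIsometryEquiv.symm_apply_eq, numberUnitary_toLp, numberRotation_numberRotation,
    add_neg_cancel, numberRotation_zero]

/-- Multiplication by the indicator function of a measurable set, on `L²(ℝ)`. -/
def indicatorOp (B : Set ℝ) (hB : MeasurableSet B) :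
    Lp ℂ 2 (volume : Measure ℝ) →L[ℂ] Lp ℂ 2 (volume : Measure ℝ) :=
  LinearMap.mkContinuous
    { toFun := fun f => ((Lp.memLp f).indicator hB).toLp _
      map_add' := fun f g => by
        apply Lp.ext
        filter_upwards [((Lp.memLp (f + g)).indicator hB).coeFn_toLp,
          ((Lp.memLp f).indicator hB).coeFn_toLp, ((Lp.memLp g).indicator hB).coeFn_toLp,
          Lp.coeFn_add f g, Lp.coeFn_add (((Lp.memLp f).indicator hB).toLp _)
            (((Lp.memLp g).indicator hB).toLp _)] with x h1 h2 h3 h4 h5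
        rw [h1, h5, Pi.add_apply, h2, h3]
        by_cases hx : x ∈ B
        · simp only [Set.indicator_of_mem hx]
          rw [h4, Pi.add_apply]
        · simp only [Set.indicator_of_notMem hx, add_zero]
      map_smul' := fun c f => by
        apply Lp.ext
        filter_upwards [((Lp.memLp (c • f)).indicator hB).coeFn_toLp,
          ((Lp.memLp f).indicator hB).coeFn_toLp, Lp.coeFn_smul c f,
          Lp.coeFn_smul c (((Lp.memLp f).indicator hB).toLp _)] with x h1 h2 h3 h4
        rw [RingHom.id_apply, h1, h4, Pi.smul_apply, h2]
        by_cases hx : x ∈ B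
        · simp only [Set.indicator_of_mem hx]
          rw [h3, Pi.smul_apply]
        · simp only [Set.indicator_of_notMem hx, smul_zero] } 1 fun f => by
    rw [one_mul]
    refine Lp.norm_le_norm_of_ae_le ?_
    filter_upwards [((Lp.memLp f).indicator hB).coeFn_toLp] with x h
    exact (congrArg norm h).trans_le (norm_indicator_le_norm_self _ _)

theorem coeFn_indicatorOp (B : Set ℝ) (hB : MeasurableSet B) (f : Lp ℂ 2 (volume : Measure ℝ)) :
    indicatorOp B hB f =ᵐ[volume] B.indicator f :=
  ((Lp.memLp f).indicator hB).coeFn_toLp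

theorem indicatorOp_indicatorOp {B C : Set ℝ} (hB : MeasurableSet B) (hC : MeasurableSet C)
    (f : Lp ℂ 2 (volume : Measure ℝ)) :
    indicatorOp B hB (indicatorOp C hC f) = indicatorOp (B ∩ C) (hB.inter hC) f := by
  apply Lp.ext
  filter_upwards [coeFn_indicatorOp B hB (indicatorOp C hC f), coeFn_indicatorOp C hC f,
    coeFn_indicatorOp (B ∩ C) (hB.inter hC) f] with x h1 h2 h3
  rw [h1, h3, ← Set.indicator_indicator]
  by_cases hx : x ∈ B <;> simp [hx, h2]

theorem indicatorOp_univ (f : Lp ℂ 2 (volume : Measure ℝ)) :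
    indicatorOp Set.univ MeasurableSet.univ f = f := by
  apply Lp.ext
  filter_upwards [coeFn_indicatorOp Set.univ MeasurableSet.univ f] with x h
  rw [h, Set.indicator_univ]

theorem inner_indicatorOp {B : Set ℝ} (hB : MeasurableSet B)
    (f g : Lp ℂ 2 (volume : Measure ℝ)) :
    inner ℂ f (indicatorOp B hB g) = ∫ x in B, inner ℂ (f x) (g x) := by
  rw [L2.inner_def, ← integral_indicator hB]
  refine integral_congr_ae ?_
  filter_upwards [coeFn_indicatorOp B hB g] with x h
  rw [h]
  by_cases hx : x ∈ B <;> simp [hx]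

theorem indicatorOp_inner {B : Set ℝ} (hB : MeasurableSet B)
    (f g : Lp ℂ 2 (volume : Measure ℝ)) :
    inner ℂ (indicatorOp B hB f) g = inner ℂ f (indicatorOp B hB g) := by
  rw [inner_indicatorOp, L2.inner_def, ← integral_indicator hB]
  refine integral_congr_ae ?_
  filter_upwards [coeFn_indicatorOp B hB f] with x h
  rw [h]
  by_cases hx : x ∈ B <;> simp [hx]

/-- The projection `e^{i θ N} 1_B(Q) e^{-i θ N}` of `L²(ℝ)`. -/
def quadratureProj (θ : ℝ) (B : Set ℝ) (hB : MeasurableSet B) :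
    Lp ℂ 2 (volume : Measure ℝ) →L[ℂ] Lp ℂ 2 (volume : Measure ℝ) :=
  ((numberUnitary θ).toContinuousLinearEquiv : Lp ℂ 2 (volume : Measure ℝ) →L[ℂ]
      Lp ℂ 2 (volume : Measure ℝ)).comp
    ((indicatorOp B hB).comp ((numberUnitary θ).symm.toContinuousLinearEquiv :
      Lp ℂ 2 (volume : Measure ℝ) →L[ℂ] Lp ℂ 2 (volume : Measure ℝ)))

theorem quadratureProj_apply (θ : ℝ) (B : Set ℝ) (hB : MeasurableSet B)
    (f : Lp ℂ 2 (volume : Measure ℝ)) : quadratureProj θ B hB f =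
      numberUnitary θ (indicatorOp B hB ((numberUnitary θ).symm f)) := rfl

theorem quadratureProj_mul (θ : ℝ) {B C : Set ℝ} (hB : MeasurableSet B) (hC : MeasurableSet C) :
    quadratureProj θ B hB * quadratureProj θ C hC = quadratureProj θ (B ∩ C) (hB.inter hC) := by
  ext1 f
  rw [mul_apply_eq_comp, quadratureProj_apply, quadratureProj_apply, quadratureProj_apply,
    LinearIsometryEquiv.symm_apply_apply, indicatorOp_indicatorOp]

theorem quadratureProj_univ (θ : ℝ) : quadratureProj θ Set.univ MeasurableSet.univ = 1 := by
  ext1 f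
  rw [quadratureProj_apply, indicatorOp_univ, LinearIsometryEquiv.apply_symm_apply]
  rfl

theorem isStarProjection_quadratureProj (θ : ℝ) {B : Set ℝ} (hB : MeasurableSet B) :
    IsStarProjection (quadratureProj θ B hB) := by
  refine ⟨?_, ?_⟩
  · have h := quadratureProj_mul θ hB hB
    simp only [Set.inter_self] at h
    exact h
  · rw [ContinuousLinearMap.isSelfAdjoint_iff_isSymmetric]
    intro f g
    change inner ℂ (quadratureProj θ B hB f) g = inner ℂ f (quadratureProj θ B hB g)
    rw [quadratureProj_apply, quadratureProj_apply, LinearIsometryEquiv.inner_map_eq_flip,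
      indicatorOp_inner, LinearIsometryEquiv.inner_map_eq_flip, LinearIsometryEquiv.symm_symm]

/-- Moving the unitary to the left vector leaves `e^{-iθN}` on both sides of the indicator, and the
integrand over `B` is the factorized form of `K`. -/
theorem inner_quadratureProj (θ : ℝ) {B : Set ℝ} (hB : MeasurableSet B) (f g : 𝓢(ℝ, ℂ)) :
    inner ℂ (f.toLp 2) (quadratureProj θ B hB (g.toLp 2)) = ∫ s in B, lineOp θ s f g := by
  rw [quadratureProj_apply, ← LinearIsometryEquiv.symm_symm (numberUnitary θ),
    ← LinearIsometryEquiv.inner_map_eq_flip, LinearIsometryEquiv.symm_symm,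
    numberUnitary_symm_toLp, numberUnitary_symm_toLp, inner_indicatorOp]
  refine setIntegral_congr_ae hB ?_
  filter_upwards [(numberRotation (-θ) f).coeFn_toLp 2, (numberRotation (-θ) g).coeFn_toLp 2]
    with x h1 h2 _
  rw [h1, h2, lineOp_apply]
  simp [mul_comm]

theorem integrable_lineOp (θ : ℝ) (f g : 𝓢(ℝ, ℂ)) : Integrable fun s : ℝ => lineOp θ s f g := by
  simp only [lineOp_apply]
  exact integrable_braket _ _

/-! ### Normal form of straight lines, axes and conjugation formulas. -/

theorem exists_eq_phaseLine (ℓ : AffineSubspace ℝ ℂ) (hℓ : Module.finrank ℝ ℓ.direction = 1) :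
    ∃ θ s : ℝ, (ℓ : Set ℂ) = phaseLine θ s := by
  obtain ⟨⟨v, hv⟩, hv0, hspan⟩ := finrank_eq_one_iff'.1 hℓ
  have hne : (ℓ : Set ℂ).Nonempty := by
    rw [AffineSubspace.nonempty_iff_ne_bot]
    intro h
    refine hv0 (Subtype.ext ?_)
    rw [h, AffineSubspace.direction_bot] at hv
    exact (Submodule.mem_bot ℝ).1 hv
  obtain ⟨z₀, hz₀⟩ := hne
  have hv0' : v ≠ 0 := fun h => hv0 (Subtype.ext h)
  have hr : ‖v‖ ≠ 0 := norm_ne_zero_iff.2 hv0'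
  have hdir : ∀ w, w ∈ ℓ.direction ↔ ∃ c : ℝ, w = c • v := by
    intro w
    constructor
    · intro hw
      obtain ⟨c, hc⟩ := hspan ⟨w, hw⟩
      exact ⟨c, (congrArg Subtype.val hc).symm⟩
    · rintro ⟨c, rfl⟩
      exact Submodule.smul_mem _ c hv
  -- Multiplication by `-i` turns the direction `v` into a normal of the line, and `θ` is its angle;
  -- thus `v = ‖v‖(-sin θ, cos θ)`.
  set θ := Complex.arg (-Complex.I * v) with hθ
  have hnorm : ‖-Complex.I * v‖ = ‖v‖ := by simp
  have hcos : v.im = ‖v‖ * Real.cos θ := by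
    have := Complex.norm_mul_cos_arg (-Complex.I * v)
    rw [hnorm] at this
    rw [hθ, this]
    simp
  have hsin : v.re = -(‖v‖ * Real.sin θ) := by
    have := Complex.norm_mul_sin_arg (-Complex.I * v)
    rw [hnorm] at this
    rw [hθ, this]
    simp
  refine ⟨θ, z₀.re * Real.cos θ + z₀.im * Real.sin θ, ?_⟩
  ext z
  have hmem : z ∈ ℓ ↔ z - z₀ ∈ ℓ.direction :=
    (AffineSubspace.vsub_right_mem_direction_iff_mem hz₀ z).symm
  rw [SetLike.mem_coe, hmem, hdir, phaseLine, Set.mem_ofPred_eq]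
  constructor
  · rintro ⟨c, hc⟩
    have h1 := congrArg Complex.re hc
    have h2 := congrArg Complex.im hc
    simp only [Complex.sub_re, Complex.sub_im, Complex.smul_re, Complex.smul_im,
      smul_eq_mul] at h1 h2
    rw [hsin] at h1
    rw [hcos] at h2
    linear_combination Real.cos θ * h1 + Real.sin θ * h2
  · intro h
    -- The component of `z - z₀` along the unit vector `(-sin θ, cos θ)`, measured in units of
    -- `‖v‖`.
    refine ⟨((z.im - z₀.im) * Real.cos θ - (z.re - z₀.re) * Real.sin θ) / ‖v‖, ?_⟩
    apply Complex.ext <;>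
      simp only [Complex.sub_re, Complex.sub_im, Complex.smul_re, Complex.smul_im, smul_eq_mul]
    · rw [hsin, mul_neg, ← mul_assoc, div_mul_cancel₀ _ hr]
      linear_combination Real.cos θ * h - (z.re - z₀.re) * Real.sin_sq_add_cos_sq θ
    · rw [hcos, ← mul_assoc, div_mul_cancel₀ _ hr]
      linear_combination Real.sin θ * h - (z.im - z₀.im) * Real.sin_sq_add_cos_sq θ

theorem lineOp_zero (s : ℝ) : lineOp 0 s = posProj s := by
  funext f g
  rw [lineOp_apply, neg_zero, numberRotation_zero, numberRotation_zero, posProj]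

theorem lineOp_pi_div_two (s : ℝ) : lineOp (Real.pi / 2) s = momProj s := by
  funext f g
  rw [lineOp_apply, ← momAmplitude_eq_numberRotation, ← momAmplitude_eq_numberRotation, momProj]

theorem posProj_eq_conjugate (q : ℝ) : posProj q = (posProj 0).conjugate (displacement (-q) 0) := by
  funext f g
  simp [posProj, GenOp.conjugate, displacement_apply]

theorem momProj_eq_conjugate (p : ℝ) : momProj p = (momProj 0).conjugate (displacement 0 (-p)) := by
  funext f g
  have h : ∀ f, momAmplitude 0 (displacement 0 (-p) f) = momAmplitude p f := fun f => by
    rw [momAmplitude_eq, momAmplitude_eq, neg_zero, displacement_zero]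
  rw [momProj, GenOp.conjugate, momProj, h, h]

theorem lineOp_eq_conjugate_posProj (θ s : ℝ) :
    lineOp θ s = (posProj s).conjugate (numberRotation (-θ)) := by
  funext f g
  rw [lineOp_apply, GenOp.conjugate, posProj]

theorem lineOp_eq_conjugate_momProj (θ s : ℝ) :
    lineOp (θ + Real.pi / 2) s = (momProj s).conjugate (numberRotation (-θ)) := by
  funext f g
  rw [lineOp_apply, GenOp.conjugate, momProj, momAmplitude_eq_numberRotation,
    momAmplitude_eq_numberRotation, numberRotation_numberRotation, numberRotation_numberRotation,
    neg_add_rev]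

theorem lineElement_zero (f g : 𝓢(ℝ, ℂ)) (t : ℝ) :
    lineElement 0 0 f g t = braket f (displacedParity 0 t g) := by
  simp [lineElement, linePoint]

theorem lineElement_pi_div_two (f g : 𝓢(ℝ, ℂ)) (t : ℝ) :
    lineElement (Real.pi / 2) 0 f g t = braket f (displacedParity (-t) 0 g) := by
  simp [lineElement, linePoint]

end PhaseSpace

end

open PhaseSpace in
theorem mainTheorem3 :
    -- every straight line in the phase plane is one of the lines `phaseLine θ s`
    (∀ ℓ : AffineSubspace ℝ ℂ, Module.finrank ℝ ℓ.direction = 1 →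
      ∃ θ s : ℝ, (ℓ : Set ℂ) = phaseLine θ s) ∧
    -- the rotations `e^{i θ N}` and the region operators of lines are given by convergent expressions
    (∀ (θ : ℝ) (f : 𝓢(ℝ, ℂ)), Summable (numberRotationTerm θ f)) ∧
    (∀ (θ s : ℝ) (f g : 𝓢(ℝ, ℂ)),
      IntegrableOn (fun z => braket f (wigner z g)) (phaseLine θ s)
        μH[1]) ∧
    -- lines parallel to the `p`-axis: smearing of parity along the axis, then displacement
    (∀ f g : 𝓢(ℝ, ℂ),
      Integrable (fun p : ℝ => braket f (displacedParity 0 p g)) ∧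
      lineOp 0 0 f g = ((Real.pi : ℝ) : ℂ)⁻¹ * ∫ p : ℝ, braket f (displacedParity 0 p g)) ∧
    (∀ q : ℝ, lineOp 0 q = (lineOp 0 0).conjugate (displacement (-q) 0) ∧
      lineOp 0 q = posProj q) ∧
    -- lines parallel to the `q`-axis
    (∀ f g : 𝓢(ℝ, ℂ),
      Integrable (fun q : ℝ => braket f (displacedParity q 0 g)) ∧
      lineOp (Real.pi / 2) 0 f g =
        ((Real.pi : ℝ) : ℂ)⁻¹ * ∫ q : ℝ, braket f (displacedParity q 0 g)) ∧
    (∀ p : ℝ, lineOp (Real.pi / 2) p = (lineOp (Real.pi / 2) 0).conjugate (displacement 0 (-p)) ∧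
      lineOp (Real.pi / 2) p = momProj p) ∧
    -- all lines: rotation by `e^{i θ N}`
    (∀ θ s : ℝ, lineOp θ s = (posProj s).conjugate (numberRotation (-θ)) ∧
      lineOp (θ + Real.pi / 2) s = (momProj s).conjugate (numberRotation (-θ))) ∧
    -- the normally ordered form, between number states and between coherent states
    (∀ (θ s : ℝ) (f g : 𝓢(ℝ, ℂ)),
      f ∈ Submodule.span ℂ (Set.range numberState) →
      g ∈ Submodule.span ℂ (Set.range numberState) →
      HasSum (normalOrderTerm (lineSymbol θ s) f g) (lineOp θ s f g)) ∧
    (∀ (θ s : ℝ) (w z : ℂ),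
      HasSum (normalOrderTerm (lineSymbol θ s) (coherentState w) (coherentState z))
        (lineOp θ s (coherentState w) (coherentState z))) ∧
    -- for each direction the line operators are the density of a projection-valued measure
    (∀ θ : ℝ, ∃ E : Set ℝ → (Lp ℂ 2 (volume : Measure ℝ)
        →L[ℂ] Lp ℂ 2 (volume : Measure ℝ)),
      (∀ B : Set ℝ, MeasurableSet B → IsStarProjection (E B) ∧
        ∀ f g : 𝓢(ℝ, ℂ),
          IntegrableOn (fun s : ℝ => lineOp θ s f g) B ∧
          inner ℂ (f.toLp 2) (E B (g.toLp 2)) = ∫ s in B, lineOp θ s f g) ∧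
      (∀ B C : Set ℝ, MeasurableSet B → MeasurableSet C → E B * E C = E (B ∩ C)) ∧
      E Set.univ = 1) := by
  classical
  refine ⟨exists_eq_phaseLine, summable_numberRotationTerm, integrableOn_phaseLine, ?_, ?_, ?_, ?_,
    fun θ s => ⟨lineOp_eq_conjugate_posProj θ s, lineOp_eq_conjugate_momProj θ s⟩,
    fun θ s f g hf hg => hasSum_normalOrderTerm_of_mem_span θ s hf hg,
    hasSum_normalOrderTerm_coherentState, ?_⟩
  · intro f g
    rw [lineOp_eq, ← funext (lineElement_zero f g)]
    exact ⟨integrable_lineElement 0 0 f g, rfl⟩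
  · intro q
    rw [lineOp_zero, lineOp_zero]
    exact ⟨posProj_eq_conjugate q, rfl⟩
  · intro f g
    -- At `θ = π/2` the parametrization runs through the `q`-axis backwards, so the sign of the
    -- parameter is reversed.
    have h := (integrable_lineElement (Real.pi / 2) 0 f g).comp_neg
    simp only [lineElement_pi_div_two, neg_neg] at h
    rw [lineOp_eq, funext (lineElement_pi_div_two f g)]
    refine ⟨h, ?_⟩
    rw [integral_neg_eq_self fun q : ℝ => braket f (displacedParity q 0 g)]
  · intro p
    rw [lineOp_pi_div_two, lineOp_pi_div_two]
    exact ⟨momProj_eq_conjugate p, rfl⟩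
  · intro θ
    refine ⟨fun B => if hB : MeasurableSet B then quadratureProj θ B hB else 0, ?_, ?_, ?_⟩
    · intro B hB
      simp only [dif_pos hB]
      exact ⟨isStarProjection_quadratureProj θ hB, fun f g =>
        ⟨(integrable_lineOp θ f g).integrableOn, inner_quadratureProj θ hB f g⟩⟩
    · intro B C hB hC
      simp only [dif_pos hB, dif_pos hC, dif_pos (hB.inter hC)]
      exact quadratureProj_mul θ hB hC
    · simp only [dif_pos MeasurableSet.univ]
      exact quadratureProj_univ θ
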